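/- **Setting.** Let $L\ge 1$ and let $\Theta^{(L)}$ be the neural tangent kernel of the infinitely wide, bias-free, fully connected ReLU network with $L$ hidden layers in the usual normalization ($\alpha^0=x$, $\alpha^{l}=\sqrt{2/m}\,\sigma(W^{l}\alpha^{l-1})$ for $1\le l\le L$, $f=\langle a,\alpha^{L}\rangle$, with i.i.d. standard Gaussian weights, all trained), i.e. the limiting kernel of $\langle\nabla_w f(w;x),\nabla_w f(w;x')\rangle$ as the width $m\to\infty$. Explicitly, with $\sigma(t)=\max(t,0)$ and $\sigma'(t)=\mathbf 1_{t>0}$, $$\Theta^{(0)}(x,x')=\Sigma^{(0)}(x,x')=\langle x,x'\rangle,\qquad \Sigma^{(l+1)}(x,x')=2\,\mathbb E[\sigma(u)\sigma(v)],$$ $$\Theta^{(l+1)}(x,x')=\Theta^{(l)}(x,x')\cdot 2\,\mathbb E[\sigma'(u)\sigma'(v)]+\Sigma^{(l+1)}(x,x'),$$ where $(u,v)$ is a centred Gaussian pair with $\operatorname{Var}u=\Sigma^{(l)}(x,x)$, $\operatorname{Cov}(u,v)=\Sigma^{(l)}(x,x')$, $\operatorname{Var}v=\Sigma^{(l)}(x',x')$.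 For inputs $x_1,\dots,x_n\in\mathbb R^d$ let $K=(\Theta^{(L)}(x_k,x_l))_{k,l}$. **Theorem 3.2.** Let $n>2$, $L\ge1$, $i\ne j$ in $\{1,\dots,n\}$, $L_y>0$, $M>0$, and fix the inputs $x_k\in\mathbb R^d$, $k\ne i,j$. Then there are constants $c,C,\theta_0>0$, depending only on these data, such that the following holds for all $x_i,x_j\in\mathbb R^d$ for which $x_1,\dots,x_n$ have unit length, are pairwise non-parallel, and the angle $\theta$ between $x_i$ and $x_j$ satisfies $\theta\le\theta_0$. There is an eigenvalue $\lambda$ of $K$ with a unit eigenvector $v$ such that $$c\,\theta\le\lambda\le C\,\theta ,$$ and for every label vector $y\in\mathbb R^n$ with $|y_k-y_l|\le L_y\|x_k-x_l\|$ for all $k,l$ and $|y_k|\le M$ for all $k$, $$(v^\top y)^2\le C\lambda^2\qquad(\text{hence } (v^\top y)^2=O(\theta^2)).$$ Moreover the order $\lambda^2$ is attained: for some such label vector $y$ also $(v^\top y)^2\ge c\,\lambda^2$. -/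

import Mathlib

open MeasureTheory ProbabilityTheory Matrix

noncomputable section

namespace InfiniteNTK

/-- The ReLU activation `σ(t) = max(t, 0)`. -/
def relu (t : ℝ) : ℝ := max t 0

/-- The derivative of ReLU, with the usual convention `σ'(0) = 0`. -/
def reluDeriv (t : ℝ) : ℝ := if 0 < t then 1 else 0

/-- The symmetric `2 × 2` matrix with rows `(p, r)` and `(r, q)`. -/
def cov2 (p r q : ℝ) : Matrix (Fin 2) (Fin 2) ℝ := !![p, r; r, q]

/-- `2 · E[φ(u) φ(v)]` for a centred Gaussian pair `(u, v)` with `Var u = p`, `Cov(u, v) = r`,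
`Var v = q`. The factor `2` is the square of the scaling `√(2 / width)` of a ReLU layer. -/
def dualActivation (φ : ℝ → ℝ) (p r q : ℝ) : ℝ :=
  2 * ∫ g : EuclideanSpace ℝ (Fin 2), φ (g 0) * φ (g 1) ∂(multivariateGaussian 0 (cov2 p r q))

variable {d : ℕ}

/-- The covariance kernel `Σ^(l)(x, x')` of the outputs of the `l`-th hidden layer
in the infinite-width limit at Gaussian initialization: `Σ^(0)(x, x') = ⟨x, x'⟩` and
`Σ^(l+1)(x, x') = 2 E[σ(u) σ(v)]`, with `(u, v)` a centred Gaussian pair whose covariance is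
that of layer `l` at `x, x'`. -/
def layerKernel : ℕ → EuclideanSpace ℝ (Fin d) → EuclideanSpace ℝ (Fin d) → ℝ
  | 0, x, x' => inner ℝ x x'
  | l + 1, x, x' =>
      dualActivation relu (layerKernel l x x) (layerKernel l x x') (layerKernel l x' x')

/-- The derivative kernel `2 E[σ'(u) σ'(v)]`, with `(u, v)` the Gaussian pair of layer `l`
at `x, x'`. -/
def layerDerivKernel (l : ℕ) (x x' : EuclideanSpace ℝ (Fin d)) : ℝ :=
  dualActivation reluDeriv (layerKernel l x x) (layerKernel l x x') (layerKernel l x' x')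

/-- The neural tangent kernel of the infinitely wide, bias-free, fully connected ReLU network
with `L` hidden layers
`α⁰ = x`, `αˡ = √(2/m) σ(Wˡ αˡ⁻¹)` for `1 ≤ l ≤ L`, `f = ⟨a, α^L⟩`,
all entries of the `Wˡ` and of `a` being independent standard Gaussians at initialization and
all of them being trained; that is, the deterministic limit of `⟨∇f(w; x), ∇f(w; x')⟩` as the
width `m` tends to infinity, given by
`Θ^(0) = Σ^(0)` and `Θ^(l+1) = Θ^(l) · 2 E[σ'(u) σ'(v)] + Σ^(l+1)`. -/
def ntk : ℕ → EuclideanSpace ℝ (Fin d) → EuclideanSpace ℝ (Fin d) → ℝ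
  | 0, x, x' => layerKernel 0 x x'
  | L + 1, x, x' => ntk L x x' * layerDerivKernel L x x' + layerKernel (L + 1) x x'

/-- The NTK matrix `K_{ij} = Θ^(L)(x_i, x_j)` of a family of inputs. -/
def ntkMatrix {n : ℕ} (L : ℕ) (x : Fin n → EuclideanSpace ℝ (Fin d)) :
    Matrix (Fin n) (Fin n) ℝ :=
  Matrix.of fun i j => ntk L (x i) (x j)

/-- The conditions on the inputs: unit length, and pairwise non-parallel. -/
structure AdmissibleInputs {n : ℕ} (x : Fin n → EuclideanSpace ℝ (Fin d)) : Prop where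
  unit : ∀ k, ‖x k‖ = 1
  nonparallel : ∀ k l, k ≠ l → ¬ ∃ c : ℝ, x k = c • x l

/-- The labels are those of an `Ly`-Lipschitz ground-truth function. -/
def LipschitzLabels {n : ℕ} (Ly : ℝ) (x : Fin n → EuclideanSpace ℝ (Fin d))
    (y : Fin n → ℝ) : Prop :=
  ∀ k l, |y k - y l| ≤ Ly * ‖x k - x l‖

end InfiniteNTK

end

/-! ### Gaussian expectations in polar coordinates -/

noncomputable section

namespace InfiniteNTK

/-! On the unit sphere the kernel depends only on the angle: polar coordinates turn the Gaussian
expectations into the arc-cosine formulas, and `ntk_eq_ntkProfile` gives `ntkProfile L` of the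
angle. This profile is Lipschitz and, for `L ≥ 1`, has the nonzero one-sided slope `-L(L+1)/(2π)` at
angle zero. Hence the dipole `e_i - e_j` has energy of order `θ`, and Rayleigh's principle yields an
eigenvalue at most of order `θ`.

Everything else rests on a dual estimate, `exists_label_bound`: `|w ⬝ᵥ y| ≤ C · max_k |(K w)_k|` for
all vectors `w` and all bounded Lipschitz `y`, uniformly in the position of the close pair. With `w
= v` an eigenvector it gives `|v ⬝ᵥ y| ≤ C λ`. With `w = y / (κ θ)` it gives the lower bound on `λ`,
provided `w`, scaled by `κ θ`, is an admissible label. Conversely `y = τ λ v` is always admissible,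
because `λ v = K v` inherits the Lipschitz bound of the kernel; it attains the order `λ²`.

To prove the dual estimate, move the mass of `w` on close inputs to one base point. The mass moved
forms dipoles, whose energies are controlled from below by the cusp of the profile. What remains
lives on separated inputs, where the kernel is coercive (`exists_coercive`): its power series in the
Gram matrix has nonnegative coefficients, and a high even entrywise power of the Gram matrix is
nearly the identity there. Since the fixed inputs are separated, at most one of them can be near the
close pair, so a cluster has at most three points; likewise at most one can be nearly antipodal to
it, and the linear term of the series deals with that pair.

One complication affects the eigenvalue. If a fixed input is much closer than `θ` to `x i` or `x j`,
the lowest eigenvalue may be far below `θ`. Then another eigenvalue is used, and the lower bound is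
tested not on its eigenvector but on a combination `u` with the lowest one that does not see the
closest pair (`exists_eigenpair`). -/

lemma posSemidef_cov2_cos (t : ℝ) : (cov2 1 (Real.cos t) 1).PosSemidef := by
  rw [posSemidef_iff_dotProduct_mulVec]
  refine ⟨?_, fun x => ?_⟩
  · ext a b
    fin_cases a <;> fin_cases b <;> simp [cov2]
  · simp only [cov2, dotProduct, mulVec, Fin.sum_univ_two, star_trivial, of_apply, cons_val_zero,
      cons_val_one, cons_val', cons_val_fin_one]
    have h : x 0 * (1 * x 0 + Real.cos t * x 1) + x 1 * (Real.cos t * x 0 + 1 * x 1) =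
        (x 0 + Real.cos t * x 1) ^ 2 + (Real.sin t * x 1) ^ 2 := by
      linear_combination (-(x 1) ^ 2) * Real.sin_sq_add_cos_sq t
    rw [h]
    positivity

/-- The Gaussian pair with unit variances and correlation `cos t`, built from two independent
standard Gaussians. -/
def gaussianPair (t : ℝ) (p : ℝ × ℝ) : EuclideanSpace ℝ (Fin 2) :=
  !₂[p.1, Real.cos t * p.1 + Real.sin t * p.2]

lemma measurable_gaussianPair (t : ℝ) : Measurable (gaussianPair t) := by
  unfold gaussianPair
  refine (WithLp.measurable_toLp 2 _).comp (measurable_pi_lambda _ fun a => ?_)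
  fin_cases a
  · simpa using measurable_fst
  · change Measurable fun p : ℝ × ℝ => Real.cos t * p.1 + Real.sin t * p.2
    fun_prop

/-- Both laws have the same characteristic function. This replaces the abstract Gaussian by one with
an explicit planar density. -/
lemma map_gaussianPair (t : ℝ) :
    ((gaussianReal 0 1).prod (gaussianReal 0 1)).map (gaussianPair t) =
      multivariateGaussian 0 (cov2 1 (Real.cos t) 1) := by
  have : IsProbabilityMeasure
      (((gaussianReal 0 1).prod (gaussianReal 0 1)).map (gaussianPair t)) :=
    Measure.isProbabilityMeasure_map (measurable_gaussianPair t).aemeasurable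
  apply Measure.ext_of_charFun
  ext x
  rw [charFun_multivariateGaussian (posSemidef_cov2_cos t), charFun_apply,
    integral_map (measurable_gaussianPair t).aemeasurable
      (Measurable.aestronglyMeasurable (by fun_prop))]
  have h : ∀ p : ℝ × ℝ,
      Complex.exp (((inner ℝ (gaussianPair t p) x : ℝ) : ℂ) * Complex.I) =
        Complex.exp (((x 0 + Real.cos t * x 1 : ℝ) : ℂ) * p.1 * Complex.I) *
          Complex.exp (((Real.sin t * x 1 : ℝ) : ℂ) * p.2 * Complex.I) := by
    intro p
    rw [← Complex.exp_add]
    congr 1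
    simp only [gaussianPair, PiLp.inner_apply, Fin.sum_univ_two, RCLike.inner_apply, conj_trivial]
    simp
    ring
  simp_rw [h]
  rw [integral_prod_mul (fun a : ℝ => Complex.exp (((x 0 + Real.cos t * x 1 : ℝ) : ℂ) * a *
    Complex.I)) (fun a : ℝ => Complex.exp (((Real.sin t * x 1 : ℝ) : ℂ) * a * Complex.I)),
    ← charFun_apply_real, ← charFun_apply_real, charFun_gaussianReal, charFun_gaussianReal,
    ← Complex.exp_add]
  congr 1
  have hs : (Real.sin t : ℂ) ^ 2 = 1 - (Real.cos t : ℂ) ^ 2 := by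
    rw [← Complex.ofReal_pow, Real.sin_sq]; push_cast; ring
  simp only [cov2, dotProduct, mulVec, Fin.sum_univ_two, of_apply, cons_val_zero,
      cons_val_one, cons_val', cons_val_fin_one, inner_zero_right]
  simp only [Complex.ofReal_add, Complex.ofReal_mul, Complex.ofReal_one, Complex.ofReal_zero,
    NNReal.coe_one, mul_zero, zero_mul, mul_pow, zero_sub]
  rw [hs]
  ring

lemma integral_gaussian_prod (f : ℝ × ℝ → ℝ) :
    ∫ p, f p ∂((gaussianReal 0 1).prod (gaussianReal 0 1)) =
      ∫ p, (2 * Real.pi)⁻¹ * Real.exp (-(p.1 ^ 2 + p.2 ^ 2) / 2) * f p := by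
  rw [gaussianReal_of_var_ne_zero 0 one_ne_zero,
    prod_withDensity (measurable_gaussianPDF 0 1) (measurable_gaussianPDF 0 1),
    integral_withDensity_eq_integral_toReal_smul]
  · rw [← Measure.volume_eq_prod]
    congr 1
    ext p
    rw [ENNReal.toReal_mul, toReal_gaussianPDF, toReal_gaussianPDF, gaussianPDFReal_def,
      smul_eq_mul]
    have h2 : (√(2 * Real.pi))⁻¹ * (√(2 * Real.pi))⁻¹ = (2 * Real.pi)⁻¹ := by
      rw [← mul_inv, Real.mul_self_sqrt (by positivity)]
    simp only [NNReal.coe_one, mul_one, sub_zero]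
    rw [← h2, show -(p.1 ^ 2 + p.2 ^ 2) / 2 = -p.1 ^ 2 / 2 + -p.2 ^ 2 / 2 by ring, Real.exp_add]
    ring
  · exact ((measurable_gaussianPDF 0 1).comp measurable_fst).mul
      ((measurable_gaussianPDF 0 1).comp measurable_snd)
  · exact ae_of_all _ fun p => ENNReal.mul_lt_top gaussianPDF_lt_top gaussianPDF_lt_top

/-- The exponent collects `r ^ k` from each of two activations homogeneous of degree `k` and one `r`
from the polar Jacobian. -/
lemma integral_radial_pow (k : ℕ) :
    ∫ r in Set.Ioi (0 : ℝ), r ^ (2 * k + 1) * Real.exp (-r ^ 2 / 2) = 2 ^ k * (k.factorial : ℝ) := by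
  have h := integral_rpow_mul_exp_neg_mul_rpow (p := 2) (q := ((2 * k + 1 : ℕ) : ℝ)) (b := 1 / 2)
    (by norm_num) (by have : (0 : ℝ) ≤ ((2 * k + 1 : ℕ) : ℝ) := Nat.cast_nonneg _
                      linarith) (by norm_num)
  have e : ((2 * k + 1 : ℕ) + 1 : ℝ) / 2 = k + 1 := by push_cast; ring
  rw [neg_div, e, Real.Gamma_nat_eq_factorial] at h
  have e2 : ((1 : ℝ) / 2) ^ (-((k : ℝ) + 1)) = 2 ^ (k + 1) := by
    rw [one_div, Real.inv_rpow (by norm_num), Real.rpow_neg (by norm_num), inv_inv]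
    exact_mod_cast Real.rpow_natCast 2 (k + 1)
  rw [e2] at h
  calc _ = ∫ x in Set.Ioi (0 : ℝ), x ^ ((2 * k + 1 : ℕ) : ℝ) * Real.exp (-(1 / 2) * x ^ (2 : ℝ)) := by
        congr 1
        ext x
        rw [Real.rpow_natCast, Real.rpow_two]
        congr 2
        ring
    _ = _ := by rw [h, pow_succ]; ring

/-- Polar coordinates for a positively homogeneous activation of degree `k`. -/
lemma dualActivation_cos_of_homogeneous (φ : ℝ → ℝ) (hm : Measurable φ) (k : ℕ)
    (hφ : ∀ r s : ℝ, 0 < r → φ (r * s) = r ^ k * φ s) (t : ℝ) :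
    dualActivation φ 1 (Real.cos t) 1 =
      2 ^ k * (k.factorial : ℝ) / Real.pi *
        ∫ s in Set.Ioo (-Real.pi) Real.pi, φ (Real.cos s) * φ (Real.cos (s - t)) := by
  unfold dualActivation
  rw [← map_gaussianPair, integral_map (measurable_gaussianPair t).aemeasurable
      (Measurable.aestronglyMeasurable (by fun_prop)), integral_gaussian_prod,
      ← integral_comp_polarCoord_symm]
  have h : ∀ p ∈ polarCoord.target, p.1 • ((2 * Real.pi)⁻¹ * Real.exp
      (-((polarCoord.symm p).1 ^ 2 + (polarCoord.symm p).2 ^ 2) / 2) *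
        (φ (gaussianPair t (polarCoord.symm p) 0) * φ (gaussianPair t (polarCoord.symm p) 1))) =
      ((2 * Real.pi)⁻¹ * (p.1 ^ (2 * k + 1) * Real.exp (-p.1 ^ 2 / 2))) *
        (φ (Real.cos p.2) * φ (Real.cos (p.2 - t))) := by
    rintro ⟨r, s⟩ ⟨hr, -⟩
    have hr : 0 < r := hr
    have e0 : gaussianPair t (polarCoord.symm (r, s)) 0 = r * Real.cos s := by
      simp [gaussianPair, polarCoord]
    have e1 : gaussianPair t (polarCoord.symm (r, s)) 1 = r * Real.cos (s - t) := by
      simp [gaussianPair, polarCoord, Real.cos_sub]; ring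
    rw [e0, e1, hφ r _ hr, hφ r _ hr]
    have e2 : (polarCoord.symm (r, s)).1 ^ 2 + (polarCoord.symm (r, s)).2 ^ 2 = r ^ 2 := by
      simp only [polarCoord_symm_apply]
      nlinarith [Real.sin_sq_add_cos_sq s]
    rw [e2, smul_eq_mul]
    ring
  rw [setIntegral_congr_fun polarCoord.open_target.measurableSet h, polarCoord_target,
    Measure.volume_eq_prod,
    setIntegral_prod_mul (fun r : ℝ => (2 * Real.pi)⁻¹ * (r ^ (2 * k + 1) * Real.exp (-r ^ 2 / 2)))
      (fun s => φ (Real.cos s) * φ (Real.cos (s - t))), integral_const_mul, integral_radial_pow]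
  have := Real.pi_ne_zero
  field_simp

/-- Two half-circles rotated by `t` meet in an arc of length `π - t`. The arc is written as an `Ioc`
minus a point to match the interval integral up to a null set. -/
lemma cos_pos_and_cos_sub_pos_iff {t s : ℝ} (h0 : 0 ≤ t) (h1 : t ≤ Real.pi)
    (hs : s ∈ Set.Ioo (-Real.pi) Real.pi) :
    (0 < Real.cos s ∧ 0 < Real.cos (s - t)) ↔
      s ∈ Set.Ioc (t - Real.pi / 2) (Real.pi / 2) \ {Real.pi / 2} := by
  obtain ⟨hs1, hs2⟩ := hs
  constructor
  · rintro ⟨c1, c2⟩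
    have l1 : -(Real.pi / 2) < s := by
      by_contra! h
      have := Real.cos_nonpos_of_pi_div_two_le_of_le (x := -s) (by linarith) (by linarith)
      rw [Real.cos_neg] at this
      linarith
    have l2 : s < Real.pi / 2 := by
      by_contra! h
      have := Real.cos_nonpos_of_pi_div_two_le_of_le (x := s) (by linarith) (by linarith)
      linarith
    have l3 : t - Real.pi / 2 < s := by
      by_contra! h
      have := Real.cos_nonpos_of_pi_div_two_le_of_le (x := t - s) (by linarith) (by linarith)
      rw [← Real.cos_neg, neg_sub] at this
      linarith
    exact ⟨⟨l3, l2.le⟩, by simpa using l2.ne⟩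
  · rintro ⟨⟨l3, l2⟩, l4⟩
    have l2 : s < Real.pi / 2 := lt_of_le_of_ne l2 (by simpa using l4)
    exact ⟨Real.cos_pos_of_mem_Ioo ⟨by linarith, l2⟩,
      Real.cos_pos_of_mem_Ioo ⟨by linarith, by linarith⟩⟩

lemma setIntegral_gate_eq {t : ℝ} (h0 : 0 ≤ t) (h1 : t ≤ Real.pi) (f g : ℝ → ℝ)
    (hf : ∀ s, 0 < Real.cos s → 0 < Real.cos (s - t) → g s = f s)
    (hg : ∀ s, ¬ (0 < Real.cos s ∧ 0 < Real.cos (s - t)) → g s = 0) :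
    ∫ s in Set.Ioo (-Real.pi) Real.pi, g s = ∫ s in (t - Real.pi / 2)..(Real.pi / 2), f s := by
  have hpi := Real.pi_pos
  have e : Set.EqOn g ((Set.Ioc (t - Real.pi / 2) (Real.pi / 2) \ {Real.pi / 2}).indicator f)
      (Set.Ioo (-Real.pi) Real.pi) := by
    intro s hs
    by_cases hc : 0 < Real.cos s ∧ 0 < Real.cos (s - t)
    · rw [Set.indicator_of_mem ((cos_pos_and_cos_sub_pos_iff h0 h1 hs).1 hc), hf s hc.1 hc.2]
    · rw [Set.indicator_of_notMem (fun h => hc ((cos_pos_and_cos_sub_pos_iff h0 h1 hs).2 h)),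
        hg s hc]
  rw [setIntegral_congr_fun measurableSet_Ioo e,
    setIntegral_indicator (measurableSet_Ioc.diff (measurableSet_singleton _)),
    intervalIntegral.integral_of_le (by linarith)]
  refine setIntegral_congr_set ?_
  rw [Set.inter_eq_right.2 ?_]
  · exact sdiff_null_ae_eq_self (by simp)
  · rintro s ⟨⟨l3, l2⟩, l4⟩
    exact ⟨by linarith, by linarith⟩

lemma dualActivation_reluDeriv_cos {t : ℝ} (h0 : 0 ≤ t) (h1 : t ≤ Real.pi) :
    dualActivation reluDeriv 1 (Real.cos t) 1 = 1 - t / Real.pi := by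
  have hpi := Real.pi_pos
  rw [dualActivation_cos_of_homogeneous reluDeriv
    (Measurable.ite measurableSet_Ioi measurable_const measurable_const) 0
    (fun r s hr => by simp [reluDeriv, hr]) t,
    setIntegral_gate_eq h0 h1 (fun _ => 1)]
  · simp
    field_simp
    ring
  · intro s h2 h3
    simp [reluDeriv, h2, h3]
  · intro s h
    simp only [reluDeriv]
    split_ifs with h2 h3 <;> simp_all

lemma integral_cos_mul_cos_sub (t : ℝ) :
    ∫ s in (t - Real.pi / 2)..(Real.pi / 2), Real.cos s * Real.cos (s - t) =
      (Real.sin t + (Real.pi - t) * Real.cos t) / 2 := by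
  have hd : ∀ s ∈ Set.uIcc (t - Real.pi / 2) (Real.pi / 2),
      HasDerivAt (fun s => (Real.sin (2 * s - t) / 2 + s * Real.cos t) / 2)
        (Real.cos s * Real.cos (s - t)) s := by
    intro s _
    have h1 : HasDerivAt (fun s : ℝ => 2 * s - t) 2 s := by
      simpa using ((hasDerivAt_id s).const_mul 2).sub_const t
    have h2 := (((h1.sin).div_const 2).add ((hasDerivAt_id s).mul_const (Real.cos t))).div_const 2
    refine h2.congr_deriv ?_
    have e1 : Real.cos (2 * s - t) = Real.cos s * Real.cos (s - t) - Real.sin s * Real.sin (s - t) := by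
      rw [← Real.cos_add]; ring_nf
    have e2 : Real.cos t = Real.cos s * Real.cos (s - t) + Real.sin s * Real.sin (s - t) := by
      rw [← Real.cos_sub]; ring_nf
    rw [e1, e2]
    ring
  rw [intervalIntegral.integral_eq_sub_of_hasDerivAt hd
    ((Continuous.intervalIntegrable (by fun_prop) _ _))]
  have e1 : Real.sin (2 * (Real.pi / 2) - t) = Real.sin t := by
    rw [show 2 * (Real.pi / 2) - t = Real.pi - t by ring, Real.sin_pi_sub]
  have e2 : Real.sin (2 * (t - Real.pi / 2) - t) = -Real.sin t := by
    rw [show 2 * (t - Real.pi / 2) - t = t - Real.pi by ring, Real.sin_sub_pi]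
  rw [e1, e2]
  ring

lemma dualActivation_relu_cos {t : ℝ} (h0 : 0 ≤ t) (h1 : t ≤ Real.pi) :
    dualActivation relu 1 (Real.cos t) 1 =
      (Real.sin t + (Real.pi - t) * Real.cos t) / Real.pi := by
  have hpi := Real.pi_pos
  rw [dualActivation_cos_of_homogeneous relu (measurable_id.max measurable_const) 1
    (fun r s hr => by simp [relu, mul_max_of_nonneg _ _ hr.le]) t,
    setIntegral_gate_eq h0 h1 (fun s => Real.cos s * Real.cos (s - t)),
    integral_cos_mul_cos_sub]
  · simp
  · intro s h2 h3
    simp [relu, h2.le, h3.le]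
  · intro s h
    simp only [relu]
    rcases not_and_or.1 h with h2 | h2 <;> simp [max_eq_right (not_lt.1 h2)]

/-! ### The angle map of one ReLU layer -/

/-- The degree one arc-cosine kernel as a function of the angle. -/
def arcCosine (t : ℝ) : ℝ := (Real.sin t + (Real.pi - t) * Real.cos t) / Real.pi

/-- The angle between the hidden representations of two inputs at angle `t`. -/
def arcMap (t : ℝ) : ℝ := Real.arccos (arcCosine t)

lemma hasDerivAt_arcCosine (t : ℝ) :
    HasDerivAt arcCosine (-((1 - t / Real.pi) * Real.sin t)) t := by
  have h := ((Real.hasDerivAt_sin t).add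
    (((hasDerivAt_id t).const_sub Real.pi).mul (Real.hasDerivAt_cos t))).div_const Real.pi
  refine h.congr_deriv ?_
  have := Real.pi_ne_zero
  simp only [id]
  field_simp
  ring

/-- The first square is that of the derivative of `arcCosine`, so this says that `arcMap` has slope
at most one. In `s = π - t` it reads `s² + sin² s - 2 s sin s cos s ≤ π²`; the left side has
derivative `4 s sin² s ≥ 0` and equals `π²` at `s = π`. -/
lemma sq_add_sq_arcCosine_le {t : ℝ} (h0 : 0 ≤ t) (h1 : t ≤ Real.pi) :
    ((1 - t / Real.pi) * Real.sin t) ^ 2 + arcCosine t ^ 2 ≤ 1 := by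
  have hpi := Real.pi_pos
  have hmono : MonotoneOn (fun s : ℝ => s ^ 2 + Real.sin s ^ 2 - 2 * s * Real.sin s * Real.cos s)
      (Set.Icc 0 Real.pi) := by
    have hd : ∀ s : ℝ, HasDerivAt
        (fun s : ℝ => s ^ 2 + Real.sin s ^ 2 - 2 * s * Real.sin s * Real.cos s)
        (4 * s * Real.sin s ^ 2) s := by
      intro s
      have h := (((hasDerivAt_id s).pow 2).add ((Real.hasDerivAt_sin s).pow 2)).sub
        ((((hasDerivAt_id s).const_mul 2).mul (Real.hasDerivAt_sin s)).mul (Real.hasDerivAt_cos s))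
      refine h.congr_deriv ?_
      simp only [id]
      norm_num
      linear_combination (-2 * s) * Real.sin_sq_add_cos_sq s
    refine monotoneOn_of_deriv_nonneg (convex_Icc _ _)
      (fun s _ => (hd s).continuousAt.continuousWithinAt)
      (fun s _ => (hd s).differentiableAt.differentiableWithinAt) ?_
    intro s hs
    rw [(hd s).deriv]
    rw [interior_Icc] at hs
    have := hs.1.le
    positivity
  have h := hmono (a := Real.pi - t) (b := Real.pi) ⟨by linarith, by linarith⟩
    ⟨hpi.le, le_rfl⟩ (by linarith)
  simp only [Real.sin_pi_sub, Real.cos_pi_sub, Real.sin_pi] at h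
  unfold arcCosine
  have e : ((1 - t / Real.pi) * Real.sin t) ^ 2 +
      ((Real.sin t + (Real.pi - t) * Real.cos t) / Real.pi) ^ 2 =
      ((Real.pi - t) ^ 2 * (Real.sin t ^ 2 + Real.cos t ^ 2) + Real.sin t ^ 2 +
        2 * (Real.pi - t) * Real.sin t * Real.cos t) / Real.pi ^ 2 := by
    field_simp
    ring
  rw [e, Real.sin_sq_add_cos_sq, div_le_one (by positivity)]
  nlinarith

lemma abs_arcCosine_le {t : ℝ} (h0 : 0 ≤ t) (h1 : t ≤ Real.pi) : |arcCosine t| ≤ 1 := by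
  rw [← sq_le_one_iff_abs_le_one]
  nlinarith [sq_add_sq_arcCosine_le h0 h1, sq_nonneg ((1 - t / Real.pi) * Real.sin t)]

lemma cos_arcMap {t : ℝ} (h0 : 0 ≤ t) (h1 : t ≤ Real.pi) :
    Real.cos (arcMap t) = arcCosine t := by
  have h := abs_le.1 (abs_arcCosine_le h0 h1)
  exact Real.cos_arccos h.1 h.2

lemma arcMap_nonneg (t : ℝ) : 0 ≤ arcMap t := Real.arccos_nonneg _

lemma arcMap_le_pi (t : ℝ) : arcMap t ≤ Real.pi := Real.arccos_le_pi _

@[simp] lemma arcMap_zero : arcMap 0 = 0 := by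
  have := Real.pi_ne_zero
  simp [arcMap, arcCosine, this]

lemma continuous_arcMap : Continuous arcMap := by
  unfold arcMap arcCosine
  fun_prop

lemma cos_le_arcCosine {t : ℝ} (h0 : 0 ≤ t) (h1 : t ≤ Real.pi) : Real.cos t ≤ arcCosine t := by
  have hpi := Real.pi_pos
  have hmono : MonotoneOn (fun s : ℝ => Real.sin s - s * Real.cos s) (Set.Icc 0 Real.pi) := by
    have hd : ∀ s : ℝ, HasDerivAt (fun s : ℝ => Real.sin s - s * Real.cos s)
        (s * Real.sin s) s := by
      intro s
      have h := (Real.hasDerivAt_sin s).sub ((hasDerivAt_id s).mul (Real.hasDerivAt_cos s))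
      refine h.congr_deriv ?_
      simp only [id]
      ring
    refine monotoneOn_of_deriv_nonneg (convex_Icc _ _)
      (fun s _ => (hd s).continuousAt.continuousWithinAt)
      (fun s _ => (hd s).differentiableAt.differentiableWithinAt) ?_
    intro s hs
    rw [(hd s).deriv]
    rw [interior_Icc] at hs
    exact mul_nonneg hs.1.le (Real.sin_nonneg_of_nonneg_of_le_pi hs.1.le hs.2.le)
  have h := hmono (a := 0) (b := t) ⟨le_rfl, hpi.le⟩ ⟨h0, h1⟩ h0
  simp only [Real.sin_zero, zero_mul, sub_zero] at h
  unfold arcCosine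
  rw [le_div_iff₀ hpi]
  linarith

lemma arcMap_le {t : ℝ} (h0 : 0 ≤ t) (h1 : t ≤ Real.pi) : arcMap t ≤ t := by
  rw [← Real.arccos_cos h0 h1]
  conv_lhs => rw [Real.arccos_cos h0 h1]
  exact Real.arccos_le_arccos (cos_le_arcCosine h0 h1)

lemma sin_arcMap_ge {t : ℝ} (h0 : 0 ≤ t) (h1 : t ≤ Real.pi) :
    (1 - t / Real.pi) * Real.sin t ≤ Real.sin (arcMap t) := by
  have hs : 0 ≤ Real.sin (arcMap t) :=
    Real.sin_nonneg_of_nonneg_of_le_pi (arcMap_nonneg t) (arcMap_le_pi t)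
  refine le_of_sq_le_sq ?_ hs
  rw [Real.sin_sq, cos_arcMap h0 h1]
  linarith [sq_add_sq_arcCosine_le h0 h1]

lemma gate_mul_sin_pos {t : ℝ} (h0 : 0 < t) (h1 : t < Real.pi) :
    0 < (1 - t / Real.pi) * Real.sin t := by
  have hpi := Real.pi_pos
  refine mul_pos ?_ (Real.sin_pos_of_pos_of_lt_pi h0 h1)
  rw [sub_pos, div_lt_one hpi]
  exact h1

lemma hasDerivAt_arcMap {t : ℝ} (h0 : 0 < t) (h1 : t < Real.pi) :
    HasDerivAt arcMap ((1 - t / Real.pi) * Real.sin t / Real.sin (arcMap t)) t := by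
  have hpos := gate_mul_sin_pos h0 h1
  have hlt : arcCosine t ^ 2 < 1 := by
    nlinarith [sq_add_sq_arcCosine_le h0.le h1.le, pow_pos hpos 2]
  have habs := abs_lt.1 ((sq_lt_one_iff_abs_lt_one _).1 hlt)
  have h := (Real.hasDerivAt_arccos habs.1.ne' habs.2.ne).comp t (hasDerivAt_arcCosine t)
  refine h.congr_deriv ?_
  have e : Real.sin (arcMap t) = √(1 - arcCosine t ^ 2) := Real.sin_arccos _
  rw [e]
  ring

lemma arcMap_sub_le {s t : ℝ} (h0 : 0 ≤ s) (hst : s ≤ t) (h1 : t ≤ Real.pi) :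
    arcMap t - arcMap s ≤ t - s := by
  have hmono : MonotoneOn (fun t : ℝ => t - arcMap t) (Set.Icc 0 Real.pi) := by
    refine monotoneOn_of_deriv_nonneg (convex_Icc _ _)
      (continuous_id.sub continuous_arcMap).continuousOn ?_ ?_ <;> rw [interior_Icc]
    · intro t ht
      exact ((hasDerivAt_id t).sub
        (hasDerivAt_arcMap ht.1 ht.2)).differentiableAt.differentiableWithinAt
    · intro t ht
      have h := (hasDerivAt_id t).sub (hasDerivAt_arcMap ht.1 ht.2)
      have e : deriv (fun t : ℝ => t - arcMap t) t = _ := h.deriv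
      have hge := sin_arcMap_ge ht.1.le ht.2.le
      rw [e, sub_nonneg, div_le_one ((gate_mul_sin_pos ht.1 ht.2).trans_le hge)]
      exact hge
  have := hmono ⟨h0, hst.trans h1⟩ ⟨h0.trans hst, h1⟩ hst
  simp only at this
  linarith

/-- Below `π / 2` the sine is increasing, so `arcMap t ≤ t` gives `sin (arcMap t) ≤ sin t` and the
slope of `arcMap` is at least `1 - t / π`. Together with `arcMap_sub_le` this yields slope one at
the origin. -/
lemma le_arcMap_sub {s t b : ℝ} (h0 : 0 ≤ s) (hst : s ≤ t) (htb : t ≤ b) (h1 : b ≤ Real.pi / 2) :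
    (1 - b / Real.pi) * (t - s) ≤ arcMap t - arcMap s := by
  have hpi := Real.pi_pos
  have hmono : MonotoneOn (fun t : ℝ => arcMap t - (1 - b / Real.pi) * t) (Set.Icc 0 b) := by
    refine monotoneOn_of_deriv_nonneg (convex_Icc _ _)
      (continuous_arcMap.sub (by fun_prop)).continuousOn ?_ ?_ <;> rw [interior_Icc]
    · intro t ht
      exact ((hasDerivAt_arcMap ht.1 (by linarith [ht.2])).sub
        ((hasDerivAt_id t).const_mul _)).differentiableAt.differentiableWithinAt
    · intro t ht
      have htp : t < Real.pi := by linarith [ht.2]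
      have h := (hasDerivAt_arcMap ht.1 htp).sub
        ((hasDerivAt_id t).const_mul (1 - b / Real.pi))
      have e : deriv (fun t : ℝ => arcMap t - (1 - b / Real.pi) * t) t = _ := h.deriv
      have hpos := gate_mul_sin_pos ht.1 htp
      have hge := hpos.trans_le (sin_arcMap_ge ht.1.le htp.le)
      have hle : Real.sin (arcMap t) ≤ Real.sin t := by
        refine Real.sin_le_sin_of_le_of_le_pi_div_two ?_ (by linarith [ht.2])
          (arcMap_le ht.1.le htp.le)
        linarith [arcMap_nonneg t]
      have htb : t / Real.pi ≤ b / Real.pi := by gcongr; exact ht.2.le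
      have hbp : b / Real.pi ≤ 1 := by rw [div_le_one hpi]; linarith
      rw [e, sub_nonneg, mul_one, le_div_iff₀ hge]
      exact mul_le_mul (by linarith) hle hge.le (by linarith)
  have := hmono ⟨h0, hst.trans htb⟩ ⟨h0.trans hst, htb⟩ hst
  simp only at this
  linarith

lemma arcMap_mono {s t : ℝ} (h0 : 0 ≤ s) (hst : s ≤ t) (h1 : t ≤ Real.pi) :
    arcMap s ≤ arcMap t := by
  have hmono : MonotoneOn arcMap (Set.Icc 0 Real.pi) := by
    refine monotoneOn_of_deriv_nonneg (convex_Icc _ _) continuous_arcMap.continuousOn ?_ ?_ <;>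
      rw [interior_Icc]
    · intro t ht
      exact (hasDerivAt_arcMap ht.1 ht.2).differentiableAt.differentiableWithinAt
    · intro t ht
      rw [(hasDerivAt_arcMap ht.1 ht.2).deriv]
      have hpos := gate_mul_sin_pos ht.1 ht.2
      exact (div_pos hpos (hpos.trans_le (sin_arcMap_ge ht.1.le ht.2.le))).le
  exact hmono ⟨h0, hst.trans h1⟩ ⟨h0.trans hst, h1⟩ hst

lemma arcMap_iterate_mem {t : ℝ} (h0 : 0 ≤ t) (h1 : t ≤ Real.pi) (l : ℕ) :
    0 ≤ arcMap^[l] t ∧ arcMap^[l] t ≤ t := by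
  induction l with
  | zero => exact ⟨h0, le_rfl⟩
  | succ l ih =>
    rw [Function.iterate_succ_apply']
    exact ⟨arcMap_nonneg _, (arcMap_le ih.1 (ih.2.trans h1)).trans ih.2⟩

@[simp] lemma arcMap_iterate_zero (l : ℕ) : arcMap^[l] 0 = 0 :=
  Function.iterate_fixed arcMap_zero l

lemma arcMap_iterate_sub {s t : ℝ} (h0 : 0 ≤ s) (hst : s ≤ t) (h1 : t ≤ Real.pi) (l : ℕ) :
    0 ≤ arcMap^[l] t - arcMap^[l] s ∧ arcMap^[l] t - arcMap^[l] s ≤ t - s := by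
  induction l with
  | zero => exact ⟨sub_nonneg.2 hst, le_rfl⟩
  | succ l ih =>
    have hs := arcMap_iterate_mem h0 (hst.trans h1) l
    have ht := arcMap_iterate_mem (h0.trans hst) h1 l
    rw [Function.iterate_succ_apply', Function.iterate_succ_apply']
    exact ⟨sub_nonneg.2 (arcMap_mono hs.1 (sub_nonneg.1 ih.1) (ht.2.trans h1)),
      (arcMap_sub_le hs.1 (sub_nonneg.1 ih.1) (ht.2.trans h1)).trans ih.2⟩

/-! ### The angular profile of the kernel and its Lipschitz bound -/

/-- The neural tangent kernel on the unit sphere as a function of the angle. -/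
def ntkProfile : ℕ → ℝ → ℝ
  | 0, t => Real.cos t
  | L + 1, t => ntkProfile L t * (1 - arcMap^[L] t / Real.pi) + Real.cos (arcMap^[L + 1] t)

@[simp] lemma ntkProfile_at_zero (L : ℕ) : ntkProfile L 0 = L + 1 := by
  induction L with
  | zero => simp [ntkProfile]
  | succ L ih => simp only [ntkProfile, ih, arcMap_iterate_zero]; simp

lemma gate_mem {t : ℝ} (h0 : 0 ≤ t) (h1 : t ≤ Real.pi) (l : ℕ) :
    0 ≤ 1 - arcMap^[l] t / Real.pi ∧ 1 - arcMap^[l] t / Real.pi ≤ 1 := by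
  have hpi := Real.pi_pos
  have h := arcMap_iterate_mem h0 h1 l
  constructor
  · rw [sub_nonneg, div_le_one hpi]
    exact h.2.trans h1
  · rw [sub_le_self_iff]
    exact div_nonneg h.1 hpi.le

lemma abs_ntkProfile_le {t : ℝ} (h0 : 0 ≤ t) (h1 : t ≤ Real.pi) (L : ℕ) :
    |ntkProfile L t| ≤ L + 1 := by
  induction L with
  | zero => simpa [ntkProfile] using Real.abs_cos_le_one t
  | succ L ih =>
    have hg := gate_mem h0 h1 L
    have h2 := Real.abs_cos_le_one (arcMap^[L + 1] t)
    simp only [ntkProfile]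
    refine (abs_add_le _ _).trans ?_
    rw [abs_mul, abs_of_nonneg hg.1]
    push_cast
    nlinarith [abs_nonneg (ntkProfile L t)]

lemma exists_ntkProfile_lipschitz (L : ℕ) :
    ∃ Λ : ℝ, 0 < Λ ∧ ∀ s t : ℝ, 0 ≤ s → s ≤ Real.pi → 0 ≤ t → t ≤ Real.pi →
      |ntkProfile L t - ntkProfile L s| ≤ Λ * |t - s| := by
  suffices h : ∃ Λ : ℝ, 0 < Λ ∧ ∀ s t : ℝ, 0 ≤ s → s ≤ t → t ≤ Real.pi →
      |ntkProfile L t - ntkProfile L s| ≤ Λ * (t - s) by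
    obtain ⟨Λ, hΛ, h⟩ := h
    refine ⟨Λ, hΛ, fun s t hs hs1 ht ht1 => ?_⟩
    rcases le_total s t with hst | hst
    · rw [abs_of_nonneg (sub_nonneg.2 hst)]
      exact h s t hs hst ht1
    · rw [abs_sub_comm, abs_sub_comm t s, abs_of_nonneg (sub_nonneg.2 hst)]
      exact h t s ht hst hs1
  have hcos : ∀ (l : ℕ) (s t : ℝ), 0 ≤ s → s ≤ t → t ≤ Real.pi →
      |Real.cos (arcMap^[l] t) - Real.cos (arcMap^[l] s)| ≤ t - s := by
    intro l s t h0 hst h1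
    have h := arcMap_iterate_sub h0 hst h1 l
    have h2 := Real.abs_cos_sub_cos_le (arcMap^[l] t) (arcMap^[l] s)
    rw [abs_of_nonneg h.1] at h2
    exact h2.trans h.2
  induction L with
  | zero => exact ⟨1, one_pos, fun s t h0 hst h1 => by simpa [ntkProfile] using hcos 0 s t h0 hst h1⟩
  | succ L ih =>
    obtain ⟨Λ, hΛ, h⟩ := ih
    refine ⟨Λ + (L + 1) + 1, by positivity, fun s t h0 hst h1 => ?_⟩
    have hpi := Real.pi_gt_three
    have hg := gate_mem h0 (hst.trans h1) L
    have hd := arcMap_iterate_sub h0 hst h1 L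
    have hb := abs_ntkProfile_le (h0.trans hst) h1 L
    have e : ntkProfile (L + 1) t - ntkProfile (L + 1) s =
        (ntkProfile L t - ntkProfile L s) * (1 - arcMap^[L] s / Real.pi) +
          -(ntkProfile L t * ((arcMap^[L] t - arcMap^[L] s) / Real.pi)) +
          (Real.cos (arcMap^[L + 1] t) - Real.cos (arcMap^[L + 1] s)) := by
      simp only [ntkProfile]
      ring
    rw [e]
    refine (abs_add_three _ _ _).trans ?_
    have h2 : |(ntkProfile L t - ntkProfile L s) * (1 - arcMap^[L] s / Real.pi)| ≤ Λ * (t - s) := by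
      rw [abs_mul, abs_of_nonneg hg.1]
      exact (mul_le_of_le_one_right (abs_nonneg _) hg.2).trans (h s t h0 hst h1)
    have h3 : |-(ntkProfile L t * ((arcMap^[L] t - arcMap^[L] s) / Real.pi))| ≤
        (L + 1) * (t - s) := by
      rw [abs_neg, abs_mul, abs_of_nonneg (div_nonneg hd.1 Real.pi_pos.le)]
      refine mul_le_mul hb ?_ (div_nonneg hd.1 Real.pi_pos.le) (by positivity)
      exact (div_le_self hd.1 (by linarith)).trans hd.2
    linarith [hcos (L + 1) s t h0 hst h1]

/-! ### The cusp of the profile at angle zero -/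

/-- `f` has strict one-sided derivative `c` at `0`. -/
def HasStrictRightDeriv (f : ℝ → ℝ) (c : ℝ) : Prop :=
  ∀ ε > 0, ∃ η > 0, ∀ s t, 0 ≤ s → s ≤ t → t ≤ η → |f t - f s - c * (t - s)| ≤ ε * (t - s)

lemma HasStrictRightDeriv.add {f g : ℝ → ℝ} {c d : ℝ} (hf : HasStrictRightDeriv f c)
    (hg : HasStrictRightDeriv g d) : HasStrictRightDeriv (fun t => f t + g t) (c + d) := by
  intro ε hε
  obtain ⟨η₁, h₁, hf⟩ := hf (ε / 2) (by positivity)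
  obtain ⟨η₂, h₂, hg⟩ := hg (ε / 2) (by positivity)
  refine ⟨min η₁ η₂, lt_min h₁ h₂, fun s t h0 hst ht => ?_⟩
  have hf := hf s t h0 hst (ht.trans (min_le_left _ _))
  have hg := hg s t h0 hst (ht.trans (min_le_right _ _))
  rw [abs_le] at *
  constructor <;> linarith [hf.1, hf.2, hg.1, hg.2]

lemma HasStrictRightDeriv.mul {f g : ℝ → ℝ} {c d : ℝ} (hf : HasStrictRightDeriv f c)
    (hg : HasStrictRightDeriv g d) :
    HasStrictRightDeriv (fun t => f t * g t) (c * g 0 + f 0 * d) := by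
  intro ε hε
  set B : ℝ := |c| + |d| + |f 0| + |g 0| + 1 with hB
  have hB1 : 1 ≤ B := by
    have := abs_nonneg c; have := abs_nonneg d; have := abs_nonneg (f 0); have := abs_nonneg (g 0)
    linarith
  have bcd : |c| + |d| ≤ B := by linarith [abs_nonneg (f 0), abs_nonneg (g 0)]
  have hcB : |c| ≤ B := by linarith [abs_nonneg d]
  have hdB : |d| ≤ B := by linarith [abs_nonneg c]
  set δ : ℝ := min 1 (ε / (8 * B ^ 2)) with hδ
  have hδ0 : 0 < δ := by positivity
  have hδ1 : δ ≤ 1 := min_le_left _ _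
  have hδε : δ * (8 * B ^ 2) ≤ ε := by
    rw [← le_div_iff₀ (by positivity)]; exact min_le_right _ _
  obtain ⟨η₁, h₁, hf⟩ := hf δ hδ0
  obtain ⟨η₂, h₂, hg⟩ := hg δ hδ0
  refine ⟨min (min η₁ η₂) δ, by positivity, fun s t h0 hst ht => ?_⟩
  have ht1 : t ≤ η₁ := ht.trans ((min_le_left _ _).trans (min_le_left _ _))
  have ht2 : t ≤ η₂ := ht.trans ((min_le_left _ _).trans (min_le_right _ _))
  have htδ : t ≤ δ := ht.trans (min_le_right _ _)
  have hf1 := hf s t h0 hst ht1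
  have hg1 := hg s t h0 hst ht2
  have hf2 := hf 0 t le_rfl (h0.trans hst) ht1
  have hg2 := hg 0 s le_rfl h0 (hst.trans ht2)
  have ft : |f t - f 0| ≤ 2 * B * δ := by
    have : f t - f 0 = (f t - f 0 - c * (t - 0)) + c * t := by ring
    rw [this]
    refine (abs_add_le _ _).trans ?_
    rw [abs_mul, abs_of_nonneg (h0.trans hst)]
    have : |c| * t ≤ B * δ := mul_le_mul hcB htδ (h0.trans hst) (by linarith)
    have : δ * (t - 0) ≤ δ * B := by gcongr; linarith
    linarith
  have gs : |g s - g 0| ≤ 2 * B * δ := by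
    have : g s - g 0 = (g s - g 0 - d * (s - 0)) + d * s := by ring
    rw [this]
    refine (abs_add_le _ _).trans ?_
    rw [abs_mul, abs_of_nonneg h0]
    have : |d| * s ≤ B * δ := mul_le_mul hdB (hst.trans htδ) h0 (by linarith)
    have : δ * (s - 0) ≤ δ * B := by gcongr; linarith
    linarith
  have e : f t * g t - f s * g s - (c * g 0 + f 0 * d) * (t - s) =
      (f t - f s - c * (t - s)) * g s + f t * (g t - g s - d * (t - s)) +
        (c * (g s - g 0) * (t - s) + (f t - f 0) * d * (t - s)) := by ring
  have hu : 0 ≤ t - s := sub_nonneg.2 hst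
  have bg : |g s| ≤ 3 * B := by
    have : |g s| ≤ |g s - g 0| + |g 0| := by
      simpa using abs_add_le (g s - g 0) (g 0)
    have : B * δ ≤ B * 1 := by gcongr
    linarith [abs_nonneg d, abs_nonneg (f 0), abs_nonneg c]
  have bf : |f t| ≤ 3 * B := by
    have : |f t| ≤ |f t - f 0| + |f 0| := by
      simpa using abs_add_le (f t - f 0) (f 0)
    have : B * δ ≤ B * 1 := by gcongr
    linarith [abs_nonneg d, abs_nonneg (g 0), abs_nonneg c]
  rw [e]
  refine (abs_add_three _ _ _).trans ?_
  have t1 : |(f t - f s - c * (t - s)) * g s| ≤ δ * (t - s) * (3 * B) := by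
    rw [abs_mul]; gcongr
  have t2 : |f t * (g t - g s - d * (t - s))| ≤ (3 * B) * (δ * (t - s)) := by
    rw [abs_mul]; gcongr
  have t3 : |c * (g s - g 0) * (t - s) + (f t - f 0) * d * (t - s)| ≤
      B * (2 * B * δ) * (t - s) := by
    refine (abs_add_le _ _).trans ?_
    simp only [abs_mul, abs_of_nonneg hu]
    rw [← add_mul]
    refine mul_le_mul_of_nonneg_right ?_ hu
    have u1 : |c| * |g s - g 0| ≤ |c| * (2 * B * δ) := by gcongr
    have u2 : |f t - f 0| * |d| ≤ 2 * B * δ * |d| := by gcongr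
    have u3 : (|c| + |d|) * (2 * B * δ) ≤ B * (2 * B * δ) := by gcongr
    linarith
  have : 8 * B ^ 2 * δ * (t - s) ≤ ε * (t - s) := by
    refine mul_le_mul_of_nonneg_right ?_ hu
    linarith
  have hBB : B ≤ B ^ 2 := by nlinarith
  have : B * (δ * (t - s)) ≤ B ^ 2 * (δ * (t - s)) := by gcongr
  linarith

lemma HasStrictRightDeriv.comp_arcMap_iterate {f : ℝ → ℝ} {c : ℝ} (hf : HasStrictRightDeriv f c)
    {l : ℕ} (hl : HasStrictRightDeriv (arcMap^[l]) 1) :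
    HasStrictRightDeriv (fun t => f (arcMap^[l] t)) c := by
  intro ε hε
  obtain ⟨η₁, h₁, hf⟩ := hf (ε / 2) (by positivity)
  obtain ⟨η₂, h₂, hl⟩ := hl (ε / (2 * (|c| + 1))) (by positivity)
  refine ⟨min (min η₁ η₂) Real.pi, lt_min (lt_min h₁ h₂) Real.pi_pos, fun s t h0 hst ht => ?_⟩
  have ht1 : t ≤ η₁ := ht.trans ((min_le_left _ _).trans (min_le_left _ _))
  have ht2 : t ≤ η₂ := ht.trans ((min_le_left _ _).trans (min_le_right _ _))
  have htp : t ≤ Real.pi := ht.trans (min_le_right _ _)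
  have hd := arcMap_iterate_sub h0 hst htp l
  have hs := arcMap_iterate_mem h0 (hst.trans htp) l
  have ht' := arcMap_iterate_mem (h0.trans hst) htp l
  have h1 := hf _ _ hs.1 (sub_nonneg.1 hd.1) (ht'.2.trans ht1)
  have h2 := hl s t h0 hst ht2
  have e : f (arcMap^[l] t) - f (arcMap^[l] s) - c * (t - s) =
      (f (arcMap^[l] t) - f (arcMap^[l] s) - c * (arcMap^[l] t - arcMap^[l] s)) +
        c * (arcMap^[l] t - arcMap^[l] s - 1 * (t - s)) := by ring
  rw [e]
  refine (abs_add_le _ _).trans ?_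
  rw [abs_mul]
  have h3 : |c| * |arcMap^[l] t - arcMap^[l] s - 1 * (t - s)| ≤ ε / 2 * (t - s) := by
    calc _ ≤ (|c| + 1) * (ε / (2 * (|c| + 1)) * (t - s)) := by gcongr; linarith
      _ = _ := by field_simp
  nlinarith [hd.2]

lemma hasStrictRightDeriv_arcMap : HasStrictRightDeriv arcMap 1 := by
  intro ε hε
  have hpi := Real.pi_pos
  refine ⟨min (Real.pi / 2) (ε * Real.pi), by positivity, fun s t h0 hst ht => ?_⟩
  have h1 := arcMap_sub_le h0 hst (by linarith [min_le_left (Real.pi / 2) (ε * Real.pi)])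
  have h2 := le_arcMap_sub h0 hst ht (min_le_left _ _)
  have h3 : min (Real.pi / 2) (ε * Real.pi) / Real.pi ≤ ε := by
    rw [div_le_iff₀ hpi]; exact min_le_right _ _
  rw [abs_le]
  constructor <;> nlinarith

lemma hasStrictRightDeriv_arcMap_iterate (l : ℕ) : HasStrictRightDeriv (arcMap^[l]) 1 := by
  induction l with
  | zero =>
    intro ε hε
    refine ⟨1, one_pos, fun s t h0 hst ht => ?_⟩
    simp only [Function.iterate_zero, id, one_mul, sub_self, abs_zero]
    exact mul_nonneg hε.le (sub_nonneg.2 hst)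
  | succ l ih =>
    have := hasStrictRightDeriv_arcMap.comp_arcMap_iterate ih
    rwa [Function.iterate_succ']

lemma hasStrictRightDeriv_cos : HasStrictRightDeriv Real.cos 0 := by
  intro ε hε
  refine ⟨ε, hε, fun s t h0 hst ht => ?_⟩
  rw [zero_mul, sub_zero, Real.cos_sub_cos, abs_mul, abs_mul]
  have h1 : |Real.sin ((t + s) / 2)| ≤ ε :=
    (Real.abs_sin_le_abs).trans (by rw [abs_of_nonneg (by linarith)]; linarith)
  have h2 : |Real.sin ((t - s) / 2)| ≤ (t - s) / 2 :=
    (Real.abs_sin_le_abs).trans (by rw [abs_of_nonneg (by linarith)])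
  have h3 : |Real.sin ((t + s) / 2)| * |Real.sin ((t - s) / 2)| ≤ ε * ((t - s) / 2) := by gcongr
  norm_num
  linarith

lemma hasStrictRightDeriv_const (a : ℝ) : HasStrictRightDeriv (fun _ => a) 0 := by
  intro ε hε
  refine ⟨1, one_pos, fun s t h0 hst ht => ?_⟩
  simp only [sub_self, zero_mul, abs_zero]
  exact mul_nonneg hε.le (sub_nonneg.2 hst)

/-- Each layer multiplies by a gate of slope `-1/π` while the profile has value `L + 1` at zero, so
the slope changes by `-(L + 1)/π`; the cosine term is flat. Strictness matters later, when two small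
nonzero angles are compared. -/
lemma hasStrictRightDeriv_ntkProfile (L : ℕ) :
    HasStrictRightDeriv (ntkProfile L) (-(L * (L + 1) / (2 * Real.pi))) := by
  have hpi := Real.pi_ne_zero
  induction L with
  | zero => simpa [ntkProfile] using hasStrictRightDeriv_cos
  | succ L ih =>
    have hg : HasStrictRightDeriv (fun t => 1 + (-1 / Real.pi) * arcMap^[L] t) _ :=
      (hasStrictRightDeriv_const 1).add
        ((hasStrictRightDeriv_const (-1 / Real.pi)).mul (hasStrictRightDeriv_arcMap_iterate L))
    have h := (ih.mul hg).add
      (hasStrictRightDeriv_cos.comp_arcMap_iterate (hasStrictRightDeriv_arcMap_iterate (L + 1)))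
    convert h using 1
    · ext t
      simp only [ntkProfile]
      ring
    · rw [ntkProfile_at_zero, arcMap_iterate_zero]
      push_cast
      field_simp
      ring

/-! ### Identification of the kernel on the unit sphere -/

section Layers

variable {d : ℕ}

lemma layerKernel_eq_cos (l : ℕ) {x x' : EuclideanSpace ℝ (Fin d)} (hx : ‖x‖ = 1)
    (hx' : ‖x'‖ = 1) :
    layerKernel l x x' = Real.cos (arcMap^[l] (InnerProductGeometry.angle x x')) := by
  induction l generalizing x x' with
  | zero =>
    simp [layerKernel, InnerProductGeometry.cos_angle, hx, hx']
  | succ l ih =>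
    have hself : ∀ {u : EuclideanSpace ℝ (Fin d)}, ‖u‖ = 1 → layerKernel l u u = 1 := by
      intro u hu
      rw [ih hu hu, InnerProductGeometry.angle_self (by rintro rfl; simp at hu)]
      simp
    have h := arcMap_iterate_mem (InnerProductGeometry.angle_nonneg x x')
      (InnerProductGeometry.angle_le_pi x x') l
    have h1 := h.2.trans (InnerProductGeometry.angle_le_pi x x')
    rw [layerKernel, hself hx, hself hx', ih hx hx', dualActivation_relu_cos h.1 h1,
      Function.iterate_succ_apply', cos_arcMap h.1 h1, arcCosine]

lemma layerDerivKernel_eq (l : ℕ) {x x' : EuclideanSpace ℝ (Fin d)} (hx : ‖x‖ = 1)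
    (hx' : ‖x'‖ = 1) :
    layerDerivKernel l x x' = 1 - arcMap^[l] (InnerProductGeometry.angle x x') / Real.pi := by
  have hself : ∀ {u : EuclideanSpace ℝ (Fin d)}, ‖u‖ = 1 → layerKernel l u u = 1 := by
    intro u hu
    rw [layerKernel_eq_cos l hu hu, InnerProductGeometry.angle_self (by rintro rfl; simp at hu)]
    simp
  have h := arcMap_iterate_mem (InnerProductGeometry.angle_nonneg x x')
    (InnerProductGeometry.angle_le_pi x x') l
  rw [layerDerivKernel, hself hx, hself hx', layerKernel_eq_cos l hx hx',
    dualActivation_reluDeriv_cos h.1 (h.2.trans (InnerProductGeometry.angle_le_pi x x'))]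

lemma ntk_eq_ntkProfile (L : ℕ) {x x' : EuclideanSpace ℝ (Fin d)} (hx : ‖x‖ = 1)
    (hx' : ‖x'‖ = 1) : ntk L x x' = ntkProfile L (InnerProductGeometry.angle x x') := by
  induction L with
  | zero => simpa [ntk, ntkProfile] using layerKernel_eq_cos 0 hx hx'
  | succ L ih =>
    rw [ntk, ih, layerDerivKernel_eq L hx hx', layerKernel_eq_cos (L + 1) hx hx', ntkProfile]

end Layers

/-! ### Entrywise functions that preserve positive semidefiniteness -/

section PositiveSemidefinite

variable {ι : Type*} [Fintype ι]

/-- The quadratic form of a matrix. -/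
def quadForm (S : Matrix ι ι ℝ) (w : ι → ℝ) : ℝ := ∑ k, ∑ l, w k * w l * S k l

lemma quadForm_eq_dotProduct (S : Matrix ι ι ℝ) (w : ι → ℝ) : quadForm S w = w ⬝ᵥ (S *ᵥ w) := by
  simp only [quadForm, dotProduct, mulVec, Finset.mul_sum]
  exact Finset.sum_congr rfl fun k _ => Finset.sum_congr rfl fun l _ => by ring

lemma posSemidef_iff_quadForm {S : Matrix ι ι ℝ} :
    S.PosSemidef ↔ (∀ k l, S l k = S k l) ∧ ∀ w, 0 ≤ quadForm S w := by
  rw [posSemidef_iff_dotProduct_mulVec]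
  refine and_congr ⟨fun h k l => ?_, fun h => ?_⟩ ?_
  · simpa using h.apply k l
  · ext k l
    simpa using h k l
  · simp [quadForm_eq_dotProduct]

lemma quadForm_sub (S T : Matrix ι ι ℝ) (w : ι → ℝ) :
    quadForm (S - T) w = quadForm S w - quadForm T w := by
  simp [quadForm, mul_sub, Finset.sum_sub_distrib]

lemma quadForm_smul (c : ℝ) (S : Matrix ι ι ℝ) (w : ι → ℝ) :
    quadForm (c • S) w = c * quadForm S w := by
  simp only [quadForm, Finset.mul_sum, Matrix.smul_apply, smul_eq_mul]
  exact Finset.sum_congr rfl fun k _ => Finset.sum_congr rfl fun l _ => by ring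

lemma posSemidef_of_const {c : ℝ} (hc : 0 ≤ c) :
    (Matrix.of fun _ _ : ι => c).PosSemidef := by
  rw [posSemidef_iff_quadForm]
  refine ⟨fun _ _ => rfl, fun w => ?_⟩
  have : quadForm (Matrix.of fun _ _ : ι => c) w = c * (∑ k, w k) ^ 2 := by
    rw [sq, Finset.sum_mul_sum, Finset.mul_sum]
    simp only [quadForm, Finset.mul_sum, of_apply]
    exact Finset.sum_congr rfl fun k _ => Finset.sum_congr rfl fun l _ => by ring
  rw [this]
  positivity

lemma posSemidef_map_pow {S : Matrix ι ι ℝ} (hS : S.PosSemidef) (n : ℕ) :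
    (S.map (· ^ n)).PosSemidef := by
  induction n with
  | zero =>
    convert posSemidef_of_const (ι := ι) zero_le_one using 1
    ext k l
    simp
  | succ n ih =>
    have e : S.map (· ^ (n + 1)) = S.map (· ^ n) ⊙ S := by
      ext k l
      simp [pow_succ]
    rw [e]
    exact ih.hadamard hS

/-- The coefficients of the power series of `(1 - u)^(-1/2)`. -/
def invSqrtCoeff (n : ℕ) : ℝ := Ring.choose ((1 / 2 : ℝ) + n - 1) n

lemma invSqrtCoeff_pos (n : ℕ) : 0 < invSqrtCoeff n := by
  have h := Ring.factorial_nsmul_multichoose_eq_ascPochhammer (1 / 2 : ℝ) n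
  rw [← Polynomial.ascPochhammer_smeval_cast ℝ, ← Polynomial.eval_eq_smeval] at h
  have h2 : 0 < (ascPochhammer ℝ n).eval (1 / 2 : ℝ) := ascPochhammer_pos n _ (by norm_num)
  rw [← h, nsmul_eq_mul] at h2
  have h3 := pos_of_mul_pos_right h2 (Nat.cast_nonneg _)
  have e : Ring.choose ((1 / 2 : ℝ) + n - 1) n = Ring.multichoose (1 / 2 : ℝ) n := by
    rw [Ring.choose]
    congr 1
    ring
  rw [invSqrtCoeff, e]
  exact h3

lemma hasSum_invSqrt {x : ℝ} (hx : |x| < 1) :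
    HasSum (fun n => invSqrtCoeff n * x ^ (2 * n)) (1 / √(1 - x ^ 2)) := by
  have h := (Real.one_div_one_sub_rpow_hasFPowerSeriesOnBall_zero (1 / 2)).hasSum (y := x ^ 2) (by
    simp only [Metric.mem_eball, edist_zero_right]
    rw [enorm_eq_nnnorm, ENNReal.coe_lt_one_iff, ← NNReal.coe_lt_coe]
    simp only [coe_nnnorm, norm_pow, Real.norm_eq_abs, NNReal.coe_one]
    exact pow_lt_one₀ (abs_nonneg x) hx two_ne_zero)
  rw [zero_add, ← Real.sqrt_eq_rpow] at h
  have e : (fun n => invSqrtCoeff n * x ^ (2 * n)) = fun n => (FormalMultilinearSeries.ofScalars ℝ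
      (fun n : ℕ => Ring.choose ((1 / 2 : ℝ) + n - 1) n) n) fun _ => x ^ 2 := by
    ext n
    rw [FormalMultilinearSeries.ofScalars_apply_eq, smul_eq_mul, invSqrtCoeff, ← pow_mul]
  rw [e]
  exact h

/-- All Taylor coefficients are positive and all entrywise powers are positive semidefinite by
Schur's theorem, so dropping one term of the series leaves a positive semidefinite matrix.
Integrating this once and twice reaches `arcsin` and `arcsinPrimitive`, including entries `±1`,
where the series above diverges. -/
lemma posSemidef_map_invSqrt_sub {T : Matrix ι ι ℝ} (hT : T.PosSemidef)
    (h1 : ∀ k l, |T k l| < 1) (m : ℕ) :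
    (T.map fun x => 1 / √(1 - x ^ 2) - invSqrtCoeff m * x ^ (2 * m)).PosSemidef := by
  rw [posSemidef_iff_quadForm] at hT ⊢
  refine ⟨fun k l => by simp [hT.1 k l], fun w => ?_⟩
  have hs : HasSum (fun n => invSqrtCoeff n * quadForm (T.map (· ^ (2 * n))) w)
      (quadForm (T.map fun x => 1 / √(1 - x ^ 2)) w) := by
    have : ∀ n, invSqrtCoeff n * quadForm (T.map (· ^ (2 * n))) w =
        ∑ k, ∑ l, w k * w l * (invSqrtCoeff n * T k l ^ (2 * n)) := by
      intro n
      simp only [quadForm, Finset.mul_sum, map_apply]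
      exact Finset.sum_congr rfl fun k _ => Finset.sum_congr rfl fun l _ => by ring
    simp_rw [this]
    exact hasSum_sum fun k _ => hasSum_sum fun l _ => (hasSum_invSqrt (h1 k l)).mul_left _
  have hle := le_hasSum hs m fun n _ => mul_nonneg (invSqrtCoeff_pos n).le
    ((posSemidef_iff_quadForm.1 (posSemidef_map_pow (posSemidef_iff_quadForm.2 hT) (2 * n))).2 w)
  have e : (T.map fun x => 1 / √(1 - x ^ 2) - invSqrtCoeff m * x ^ (2 * m)) =
      (T.map fun x => 1 / √(1 - x ^ 2)) - invSqrtCoeff m • T.map (· ^ (2 * m)) := by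
    ext k l
    simp
  rw [e, quadForm_sub, quadForm_smul]
  linarith

/-- A function preserves positive semidefiniteness of matrices with entries in `[-1, 1]` if its
derivative does so on matrices with entries in `(-1, 1)`. -/
lemma posSemidef_map_of_hasDerivAt {f f' : ℝ → ℝ} (hf : Continuous f) (hf0 : 0 ≤ f 0)
    (hd : ∀ x, |x| < 1 → HasDerivAt f (f' x) x)
    (hf' : ∀ T : Matrix ι ι ℝ, T.PosSemidef → (∀ k l, |T k l| < 1) → (T.map f').PosSemidef)
    {S : Matrix ι ι ℝ} (hS : S.PosSemidef) (h1 : ∀ k l, |S k l| ≤ 1) :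
    (S.map f).PosSemidef := by
  have hS' := posSemidef_iff_quadForm.1 hS
  rw [posSemidef_iff_quadForm]
  refine ⟨fun k l => by simp [hS'.1 k l], fun w => ?_⟩
  have hder : ∀ t ∈ Set.Ioo (0 : ℝ) 1, HasDerivAt (fun t => quadForm (S.map fun x => f (t * x)) w)
      (quadForm (S ⊙ (t • S).map f') w) t := by
    intro t ht
    simp only [quadForm, map_apply, hadamard_apply, Matrix.smul_apply, smul_eq_mul]
    refine HasDerivAt.fun_sum fun k _ => HasDerivAt.fun_sum fun l _ => ?_
    have hlt : |t * S k l| < 1 := by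
      rw [abs_mul, abs_of_pos ht.1]
      nlinarith [h1 k l, abs_nonneg (S k l), ht.1, ht.2]
    have h2 := ((hd _ hlt).comp t ((hasDerivAt_id t).mul_const (S k l))).const_mul (w k * w l)
    refine h2.congr_deriv ?_
    ring
  have hmono : MonotoneOn (fun t => quadForm (S.map fun x => f (t * x)) w) (Set.Icc 0 1) := by
    refine monotoneOn_of_deriv_nonneg (convex_Icc _ _) ?_ ?_ ?_
    · simp only [quadForm, map_apply]
      exact Continuous.continuousOn (by fun_prop)
    · rw [interior_Icc]
      exact fun t ht => (hder t ht).differentiableAt.differentiableWithinAt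
    · rw [interior_Icc]
      intro t ht
      rw [(hder t ht).deriv]
      refine (posSemidef_iff_quadForm.1 (hS.hadamard (hf' _ (hS.smul ht.1.le) fun k l => ?_))).2 w
      simp only [Matrix.smul_apply, smul_eq_mul]
      rw [abs_mul, abs_of_pos ht.1]
      nlinarith [h1 k l, abs_nonneg (S k l), ht.1, ht.2]
  -- At `t = 0` the matrix is constant with entry `f 0 ≥ 0`, hence positive semidefinite.
  have h := hmono (a := 0) (b := 1) (by simp) (by simp) zero_le_one
  simp only [zero_mul, one_mul] at h
  refine le_trans ?_ h
  exact (posSemidef_iff_quadForm.1 (posSemidef_of_const (ι := ι) hf0)).2 w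

lemma posSemidef_map_arcsin_sub {S : Matrix ι ι ℝ} (hS : S.PosSemidef)
    (h1 : ∀ k l, |S k l| ≤ 1) (m : ℕ) :
    (S.map fun x => Real.arcsin x -
      invSqrtCoeff m / (2 * m + 1) * x ^ (2 * m + 1)).PosSemidef := by
  refine posSemidef_map_of_hasDerivAt (by fun_prop) (by simp) (fun x hx => ?_)
    (fun T hT hT1 => posSemidef_map_invSqrt_sub hT hT1 m) hS h1
  have hx' := abs_lt.1 hx
  have h := (Real.hasDerivAt_arcsin hx'.1.ne' hx'.2.ne).sub
    ((hasDerivAt_pow (2 * m + 1) x).const_mul (invSqrtCoeff m / (2 * m + 1)))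
  refine h.congr_deriv ?_
  have : (2 * (m : ℝ) + 1) ≠ 0 := by positivity
  push_cast
  field_simp

/-- A primitive of the arcsine. -/
def arcsinPrimitive (x : ℝ) : ℝ := √(1 - x ^ 2) + x * Real.arcsin x

lemma posSemidef_map_arcsinPrimitive_sub {S : Matrix ι ι ℝ} (hS : S.PosSemidef)
    (h1 : ∀ k l, |S k l| ≤ 1) (m : ℕ) :
    (S.map fun x => arcsinPrimitive x -
      invSqrtCoeff m / ((2 * m + 1) * (2 * m + 2)) * x ^ (2 * m + 2)).PosSemidef := by
  refine posSemidef_map_of_hasDerivAt (by unfold arcsinPrimitive; fun_prop)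
    (by simp [arcsinPrimitive]) (fun x hx => ?_)
    (fun T hT hT1 => posSemidef_map_arcsin_sub hT (fun k l => (hT1 k l).le) m) hS h1
  have hx' := abs_lt.1 hx
  have hpos : 0 < 1 - x ^ 2 := by
    have := (sq_lt_one_iff_abs_lt_one x).2 hx
    linarith
  have h := ((((hasDerivAt_pow 2 x).const_sub 1).sqrt hpos.ne').add ((hasDerivAt_id x).mul
    (Real.hasDerivAt_arcsin hx'.1.ne' hx'.2.ne))).sub ((hasDerivAt_pow (2 * m + 2) x).const_mul
      (invSqrtCoeff m / ((2 * m + 1) * (2 * m + 2))))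
  refine h.congr_deriv ?_
  have : (2 * (m : ℝ) + 1) ≠ 0 := by positivity
  have : (2 * (m : ℝ) + 2) ≠ 0 := by positivity
  have : √(1 - x ^ 2) ≠ 0 := (Real.sqrt_pos.2 hpos).ne'
  push_cast
  simp only [id]
  field_simp
  ring

end PositiveSemidefinite

/-! ### Coercivity of the kernel matrix on separated inputs -/

section KernelMatrices

variable {ι : Type*} {d : ℕ}

/-- The Gram matrix of the hidden representations. -/
def layerMatrix (l : ℕ) (x : ι → EuclideanSpace ℝ (Fin d)) : Matrix ι ι ℝ :=
  Matrix.of fun k m => Real.cos (arcMap^[l] (InnerProductGeometry.angle (x k) (x m)))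

/-- The matrix of the derivative kernel. -/
def gateMatrix (l : ℕ) (x : ι → EuclideanSpace ℝ (Fin d)) : Matrix ι ι ℝ :=
  Matrix.of fun k m => 1 - arcMap^[l] (InnerProductGeometry.angle (x k) (x m)) / Real.pi

/-- The matrix of the neural tangent kernel as a function of the angles. -/
def profileMatrix (L : ℕ) (x : ι → EuclideanSpace ℝ (Fin d)) : Matrix ι ι ℝ :=
  Matrix.of fun k m => ntkProfile L (InnerProductGeometry.angle (x k) (x m))

lemma abs_layerMatrix_le (l : ℕ) (x : ι → EuclideanSpace ℝ (Fin d)) (k m : ι) :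
    |layerMatrix l x k m| ≤ 1 := Real.abs_cos_le_one _

lemma layerMatrix_succ (l : ℕ) (x : ι → EuclideanSpace ℝ (Fin d)) :
    layerMatrix (l + 1) x =
      (layerMatrix l x).map fun r => r / 2 + arcsinPrimitive r / Real.pi := by
  ext k m
  have h := arcMap_iterate_mem (InnerProductGeometry.angle_nonneg (x k) (x m))
    (InnerProductGeometry.angle_le_pi (x k) (x m)) l
  have h1 := h.2.trans (InnerProductGeometry.angle_le_pi (x k) (x m))
  have hpi := Real.pi_ne_zero
  simp only [layerMatrix, of_apply, map_apply]
  rw [Function.iterate_succ_apply', cos_arcMap h.1 h1, arcsinPrimitive,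
    ← Real.sin_eq_sqrt_one_sub_cos_sq h.1 h1, Real.arcsin_eq_pi_div_two_sub_arccos,
    Real.arccos_cos h.1 h1, arcCosine]
  field_simp
  ring

lemma gateMatrix_eq (l : ℕ) (x : ι → EuclideanSpace ℝ (Fin d)) :
    gateMatrix l x = (layerMatrix l x).map fun r => 1 / 2 + Real.arcsin r / Real.pi := by
  ext k m
  have h := arcMap_iterate_mem (InnerProductGeometry.angle_nonneg (x k) (x m))
    (InnerProductGeometry.angle_le_pi (x k) (x m)) l
  have h1 := h.2.trans (InnerProductGeometry.angle_le_pi (x k) (x m))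
  have hpi := Real.pi_ne_zero
  simp only [layerMatrix, gateMatrix, of_apply, map_apply]
  rw [Real.arcsin_eq_pi_div_two_sub_arccos, Real.arccos_cos h.1 h1]
  field_simp
  ring

lemma profileMatrix_succ (L : ℕ) (x : ι → EuclideanSpace ℝ (Fin d)) :
    profileMatrix (L + 1) x =
      profileMatrix L x ⊙ gateMatrix L x + layerMatrix (L + 1) x := by
  ext k m
  simp [profileMatrix, gateMatrix, layerMatrix, ntkProfile]

variable [Fintype ι]

lemma quadForm_layerMatrix_zero {x : ι → EuclideanSpace ℝ (Fin d)} (hx : ∀ k, ‖x k‖ = 1)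
    (w : ι → ℝ) : quadForm (layerMatrix 0 x) w = ‖∑ k, w k • x k‖ ^ 2 := by
  rw [← real_inner_self_eq_norm_sq, sum_inner]
  refine Finset.sum_congr rfl fun k _ => ?_
  rw [inner_sum]
  refine Finset.sum_congr rfl fun l _ => ?_
  rw [real_inner_smul_left, real_inner_smul_right]
  simp only [layerMatrix, of_apply, Function.iterate_zero, id, InnerProductGeometry.cos_angle, hx]
  ring

lemma layerMatrix_posSemidef (l : ℕ) {x : ι → EuclideanSpace ℝ (Fin d)} (hx : ∀ k, ‖x k‖ = 1) :
    (layerMatrix l x).PosSemidef := by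
  induction l with
  | zero =>
    rw [posSemidef_iff_quadForm]
    refine ⟨fun k m => by simp [layerMatrix, InnerProductGeometry.angle_comm], fun w => ?_⟩
    rw [quadForm_layerMatrix_zero hx]
    positivity
  | succ l ih =>
    have h := posSemidef_map_arcsinPrimitive_sub ih (abs_layerMatrix_le l x) 0
    have h2 := posSemidef_map_pow ih 2
    have e : layerMatrix (l + 1) x = (1 / 2 : ℝ) • layerMatrix l x +
        (1 / Real.pi) • (((layerMatrix l x).map fun r => arcsinPrimitive r -
      invSqrtCoeff 0 / ((2 * (0 : ℕ) + 1) * (2 * (0 : ℕ) + 2)) * r ^ (2 * 0 + 2)) +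
      (invSqrtCoeff 0 / 2) • (layerMatrix l x).map (· ^ 2)) := by
      rw [layerMatrix_succ]
      ext k m
      simp
      ring
    rw [e]
    exact (ih.smul (by norm_num)).add ((h.add (h2.smul
      (by have := invSqrtCoeff_pos 0; positivity))).smul (by have := Real.pi_pos; positivity))

lemma gateMatrix_sub_posSemidef (l : ℕ) {x : ι → EuclideanSpace ℝ (Fin d)}
    (hx : ∀ k, ‖x k‖ = 1) :
    (gateMatrix l x - Matrix.of fun _ _ => (1 / 2 : ℝ)).PosSemidef := by
  have hS := layerMatrix_posSemidef l hx
  have h := posSemidef_map_arcsin_sub hS (abs_layerMatrix_le l x) 0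
  have e : (gateMatrix l x - Matrix.of fun _ _ => (1 / 2 : ℝ)) =
      (1 / Real.pi) • (((layerMatrix l x).map fun r => Real.arcsin r -
        invSqrtCoeff 0 / (2 * (0 : ℕ) + 1) * r ^ (2 * 0 + 1)) +
        invSqrtCoeff 0 • layerMatrix l x) := by
    rw [gateMatrix_eq]
    ext k m
    simp
    ring
  rw [e]
  exact (h.add (hS.smul (invSqrtCoeff_pos 0).le)).smul (by have := Real.pi_pos; positivity)

lemma gateMatrix_posSemidef (l : ℕ) {x : ι → EuclideanSpace ℝ (Fin d)}
    (hx : ∀ k, ‖x k‖ = 1) : (gateMatrix l x).PosSemidef := by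
  have := (gateMatrix_sub_posSemidef l hx).add (posSemidef_of_const (ι := ι) (c := 1 / 2)
    (by norm_num))
  rwa [sub_add_cancel] at this

lemma profileMatrix_posSemidef (L : ℕ) {x : ι → EuclideanSpace ℝ (Fin d)}
    (hx : ∀ k, ‖x k‖ = 1) : (profileMatrix L x).PosSemidef := by
  induction L with
  | zero => exact layerMatrix_posSemidef 0 hx
  | succ L ih =>
    rw [profileMatrix_succ]
    exact (ih.hadamard (gateMatrix_posSemidef L hx)).add (layerMatrix_posSemidef (L + 1) hx)

/-- The gate is `1/2` plus a positive semidefinite matrix, so Schur's theorem lets lower bounds pass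
from depth `L` to `L + 1` at the cost of a factor two. -/
lemma half_quadForm_profileMatrix_le (L : ℕ) {x : ι → EuclideanSpace ℝ (Fin d)}
    (hx : ∀ k, ‖x k‖ = 1) (w : ι → ℝ) :
    quadForm (profileMatrix L x) w / 2 ≤ quadForm (profileMatrix (L + 1) x) w := by
  have h := ((profileMatrix_posSemidef L hx).hadamard (gateMatrix_sub_posSemidef L hx)).add
    (layerMatrix_posSemidef (L + 1) hx)
  have e : profileMatrix L x ⊙ (gateMatrix L x - Matrix.of fun _ _ => (1 / 2 : ℝ)) +
      layerMatrix (L + 1) x = profileMatrix (L + 1) x - (1 / 2 : ℝ) • profileMatrix L x := by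
    rw [profileMatrix_succ]
    ext k m
    simp
    ring
  have h2 := (posSemidef_iff_quadForm.1 h).2 w
  rw [e, quadForm_sub, quadForm_smul] at h2
  linarith

/-- Two terms of the series are kept: the linear one, which distinguishes antipodal inputs, and a
power `2m + 2`, which is close to the identity on separated inputs. Depth one already contains both.
-/
lemma exists_quadForm_lower_bound (m : ℕ) {L : ℕ} (hL : 1 ≤ L) :
    ∃ c : ℝ, 0 < c ∧ ∀ x : ι → EuclideanSpace ℝ (Fin d), (∀ k, ‖x k‖ = 1) → ∀ w : ι → ℝ,
      c * (quadForm (layerMatrix 0 x) w + quadForm ((layerMatrix 0 x).map (· ^ (2 * m + 2))) w) ≤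
        quadForm (profileMatrix L x) w := by
  have hpi := Real.pi_pos
  induction L, hL using Nat.le_induction with
  | base =>
    set a : ℝ := invSqrtCoeff m / ((2 * m + 1) * (2 * m + 2)) with ha
    have ha0 : 0 < a := div_pos (invSqrtCoeff_pos m) (by positivity)
    refine ⟨min (1 / 2) (a / Real.pi), by positivity, fun x hx w => ?_⟩
    have hS := layerMatrix_posSemidef 0 hx
    have h := ((hS.hadamard (gateMatrix_posSemidef 0 hx))).add
      ((posSemidef_map_arcsinPrimitive_sub hS (abs_layerMatrix_le 0 x) m).smul
        (one_div_pos.2 hpi).le)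
    have e : layerMatrix 0 x ⊙ gateMatrix 0 x + (1 / Real.pi) •
        ((layerMatrix 0 x).map fun r => arcsinPrimitive r -
          invSqrtCoeff m / ((2 * m + 1) * (2 * m + 2)) * r ^ (2 * m + 2)) =
        profileMatrix 1 x - (1 / 2 : ℝ) • layerMatrix 0 x -
          (a / Real.pi) • (layerMatrix 0 x).map (· ^ (2 * m + 2)) := by
      rw [profileMatrix_succ, layerMatrix_succ]
      ext k l
      simp only [hadamard_apply, Matrix.add_apply, Matrix.sub_apply, Matrix.smul_apply, map_apply,
        smul_eq_mul, ha, profileMatrix, layerMatrix, of_apply, ntkProfile, Function.iterate_zero,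
        id]
      ring
    have h2 := (posSemidef_iff_quadForm.1 h).2 w
    rw [e, quadForm_sub, quadForm_sub, quadForm_smul, quadForm_smul] at h2
    have p1 := (posSemidef_iff_quadForm.1 hS).2 w
    have p2 := (posSemidef_iff_quadForm.1 (posSemidef_map_pow hS (2 * m + 2))).2 w
    have q1 := mul_le_mul_of_nonneg_right (min_le_left (1 / 2) (a / Real.pi)) p1
    have q2 := mul_le_mul_of_nonneg_right (min_le_right (1 / 2) (a / Real.pi)) p2
    linarith
  | succ L hL ih =>
    obtain ⟨c, hc, h⟩ := ih
    refine ⟨c / 2, by positivity, fun x hx w => ?_⟩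
    linarith [h x hx w, half_quadForm_profileMatrix_le L hx w]

/-- Uniform coercivity of the neural tangent kernel on separated inputs, where one pair
`p, q` may be nearly antipodal. -/
lemma exists_coercive {L : ℕ} (hL : 1 ≤ L) {b : ℝ} (hb0 : 0 ≤ b) (hb : b < 1) :
    ∃ μ : ℝ, 0 < μ ∧ ∀ x : ι → EuclideanSpace ℝ (Fin d), (∀ k, ‖x k‖ = 1) →
      ∀ p q : ι, p ≠ q → ∀ w : ι → ℝ,
      (∀ k l, k ≠ l → w k ≠ 0 → w l ≠ 0 → |inner ℝ (x k) (x l)| ≤ b ∨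
        (inner ℝ (x k) (x l) ≤ 0 ∧ (k = p ∧ l = q ∨ k = q ∧ l = p))) →
      μ * ∑ k, w k ^ 2 ≤ quadForm (profileMatrix L x) w := by
  classical
  -- The added one keeps `n` positive when `ι` is empty.
  set n : ℝ := Fintype.card ι + 1 with hn
  have hn1 : 1 ≤ n := by rw [hn]; linarith [Nat.cast_nonneg (α := ℝ) (Fintype.card ι)]
  obtain ⟨m, hm⟩ : ∃ m : ℕ, b ^ (2 * m + 2) ≤ 1 / (8 * n ^ 2) := by
    obtain ⟨m, hm⟩ := exists_pow_lt_of_lt_one (show 0 < 1 / (8 * n ^ 2) by positivity) hb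
    exact ⟨m, (pow_le_pow_of_le_one hb0 hb.le (by omega)).trans hm.le⟩
  obtain ⟨c, hc, hlow⟩ := exists_quadForm_lower_bound (ι := ι) (d := d) m hL
  refine ⟨c * (1 / (8 * n)), by positivity, fun x hx p q hpq w hw => ?_⟩
  refine le_trans ?_ (hlow x hx w)
  rw [mul_assoc]
  refine mul_le_mul_of_nonneg_left ?_ hc.le
  set β : ℝ := b ^ (2 * m + 2) with hβ
  have hβ0 : 0 ≤ β := by positivity
  set r : ι → ι → ℝ := fun k l => inner ℝ (x k) (x l) with hr
  have hlay : ∀ k l, layerMatrix 0 x k l = r k l := by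
    intro k l
    simp [layerMatrix, InnerProductGeometry.cos_angle, hx, hr]
  have hrself : ∀ k, r k k = 1 := fun k => by simp [hr, hx]
  have hrcomm : ∀ k l, r k l = r l k := fun k l => real_inner_comm _ _
  have hr1 : ∀ k l, |r k l| ≤ 1 := fun k l => hlay k l ▸ abs_layerMatrix_le 0 x k l
  set W := ∑ k, w k ^ 2 with hW
  have hW0 : 0 ≤ W := Finset.sum_nonneg fun k _ => sq_nonneg _
  set s := ∑ k, |w k| with hs
  have hsW : s ^ 2 ≤ n * W := by
    have h := sq_sum_le_card_mul_sum_sq (s := Finset.univ) (f := fun k => |w k|)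
    simp only [sq_abs, Finset.card_univ] at h
    rw [hn]
    linarith
  set Q₁ := quadForm (layerMatrix 0 x) w with hQ₁
  set Q₂ := quadForm ((layerMatrix 0 x).map (· ^ (2 * m + 2))) w with hQ₂
  have p1 : 0 ≤ Q₁ := (posSemidef_iff_quadForm.1 (layerMatrix_posSemidef 0 hx)).2 w
  have hβs : β * s ^ 2 ≤ W * (1 / (8 * n)) := by
    calc β * s ^ 2 ≤ 1 / (8 * n ^ 2) * (n * W) :=
          mul_le_mul hm hsW (sq_nonneg _) (by positivity)
      _ = W * (1 / (8 * n)) := by field_simp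
  have hn8 : 1 / (8 * n) ≤ 1 / 8 := by
    apply one_div_le_one_div_of_le <;> linarith
  -- The possible loss in `Q₂` from a nearly antipodal pair: an even power cannot tell `x` from
  -- `-x`, so that entry may be near `1` and hurts exactly when `w p` and `w q` have opposite signs.
  set P₀ : ℝ := if |r p q| ≤ b then 0 else min (w p * w q) 0 with hP₀
  have hP₀0 : P₀ ≤ 0 := by
    rw [hP₀]; split_ifs
    · exact le_rfl
    · exact min_le_right _ _
  have hQ₂low : W - β * s ^ 2 + 2 * P₀ ≤ Q₂ := by
    have hpt : ∀ k l, (if k = l then w k ^ 2 else 0) - β * (|w k| * |w l|) +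
        ((if k = p then if l = q then P₀ else 0 else 0) +
          (if k = q then if l = p then P₀ else 0 else 0)) ≤ w k * w l * r k l ^ (2 * m + 2) := by
      intro k l
      have he : Even (2 * m + 2) := ⟨m + 1, by ring⟩
      have hcorr : ((if k = p then if l = q then P₀ else 0 else 0) +
          (if k = q then if l = p then P₀ else 0 else 0)) ≤ 0 := by
        split_ifs <;> linarith
      have habs : 0 ≤ β * (|w k| * |w l|) := by positivity
      by_cases hkl : k = l
      · subst hkl
        rw [hrself, one_pow, if_pos rfl]
        nlinarith
      rw [if_neg hkl]
      have hsmall : |r k l| ≤ b → -(β * (|w k| * |w l|)) ≤ w k * w l * r k l ^ (2 * m + 2) := by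
        intro h
        have h1 : |r k l| ^ (2 * m + 2) ≤ β := pow_le_pow_left₀ (abs_nonneg _) h _
        have h2 : |w k * w l * r k l ^ (2 * m + 2)| ≤ β * (|w k| * |w l|) := by
          rw [abs_mul, abs_mul, abs_pow, mul_comm]
          exact mul_le_mul_of_nonneg_right h1 (by positivity)
        exact (abs_le.1 h2).1
      by_cases hk : w k = 0
      · rw [hk]; simp only [abs_zero]; linarith
      by_cases hl : w l = 0
      · rw [hl]; simp only [abs_zero]; linarith
      by_cases hb' : |r k l| ≤ b
      · linarith [hsmall hb']
      have hpow0 : 0 ≤ r k l ^ (2 * m + 2) := he.pow_nonneg _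
      have hpow1 : r k l ^ (2 * m + 2) ≤ 1 := by
        rw [← he.pow_abs]
        exact pow_le_one₀ (abs_nonneg _) (hr1 k l)
      have hmin : min (w k * w l) 0 ≤ w k * w l * r k l ^ (2 * m + 2) := by
        rcases le_total 0 (w k * w l) with h | h
        · rw [min_eq_right h]; positivity
        · rw [min_eq_left h]; nlinarith
      rcases (hw k l hkl hk hl).resolve_left hb' with ⟨-, ⟨rfl, rfl⟩ | ⟨rfl, rfl⟩⟩
      · have : P₀ = min (w k * w l) 0 := by rw [hP₀, if_neg hb']
        rw [if_pos rfl, if_pos rfl, if_neg hkl]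
        linarith
      · have : P₀ = min (w k * w l) 0 := by
          rw [hP₀, if_neg (by rwa [hrcomm]), mul_comm]
        rw [if_neg hkl, if_pos rfl, if_pos rfl]
        linarith
    have hsum := Finset.sum_le_sum fun k (_ : k ∈ Finset.univ) =>
      Finset.sum_le_sum fun l (_ : l ∈ Finset.univ) => hpt k l
    have e1 : ∑ k, ∑ l, (if k = l then w k ^ 2 else 0) = W := by simp [hW]
    have e2 : ∑ k, ∑ l, β * (|w k| * |w l|) = β * s ^ 2 := by
      rw [sq, hs, Finset.sum_mul_sum, Finset.mul_sum]
      exact Finset.sum_congr rfl fun k _ => by rw [Finset.mul_sum]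
    have e3 : ∀ a c : ι, ∑ k, ∑ l, (if k = a then if l = c then P₀ else 0 else 0) = P₀ := by
      intro a c
      have : ∀ k, ∑ l, (if k = a then if l = c then P₀ else 0 else 0) =
          if k = a then P₀ else 0 := by
        intro k
        split_ifs <;> simp
      simp_rw [this]
      simp
    simp only [Finset.sum_add_distrib, Finset.sum_sub_distrib] at hsum
    rw [e1, e2, e3, e3] at hsum
    have e4 : Q₂ = ∑ k, ∑ l, w k * w l * r k l ^ (2 * m + 2) := by
      simp only [hQ₂, quadForm, map_apply, hlay]
    linarith
  by_cases hP : P₀ = 0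
  · rw [hP] at hQ₂low
    have : W * (1 / (8 * n)) ≤ W * (1 / 8) := by gcongr
    linarith
  have hbig : ¬ |r p q| ≤ b := fun h => hP (by rw [hP₀, if_pos h])
  have hneg : w p * w q < 0 := by
    by_contra! h
    exact hP (by rw [hP₀, if_neg hbig, min_eq_right h])
  have hP₀' : P₀ = w p * w q := by rw [hP₀, if_neg hbig, min_eq_left hneg.le]
  have hp0 : w p ≠ 0 := fun h => by simp [h] at hneg
  have hq0 : w q ≠ 0 := fun h => by simp [h] at hneg
  have hrneg : r p q ≤ 0 := ((hw p q hpq hp0 hq0).resolve_left hbig).1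
  set R := ∑ k ∈ (Finset.univ.erase p).erase q, w k ^ 2 with hR
  have hqmem : q ∈ Finset.univ.erase p := Finset.mem_erase.2 ⟨hpq.symm, Finset.mem_univ _⟩
  have hWR : W = w p ^ 2 + w q ^ 2 + R := by
    rw [hW, ← Finset.add_sum_erase _ _ (Finset.mem_univ p), ← Finset.add_sum_erase _ _ hqmem,
      add_assoc]
  have hR0 : 0 ≤ R := Finset.sum_nonneg fun k _ => sq_nonneg _
  -- Opposite signs and a nonpositive inner product do not cancel in `w p • x p + w q • x q`, so the
  -- linear term recovers what `Q₂` lost, up to the mass `R` of the other coordinates.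
  have hQ₁low : (w p ^ 2 + w q ^ 2) / 2 - n * R ≤ Q₁ := by
    set A := w p • x p + w q • x q with hA
    set B := ∑ k ∈ (Finset.univ.erase p).erase q, w k • x k with hB
    have hAB : ∑ k, w k • x k = A + B := by
      rw [← Finset.add_sum_erase _ _ (Finset.mem_univ p), ← Finset.add_sum_erase _ _ hqmem,
        ← add_assoc]
    have hnA : w p ^ 2 + w q ^ 2 ≤ ‖A‖ ^ 2 := by
      rw [hA, norm_add_sq_real, norm_smul, norm_smul, hx, hx, real_inner_smul_left,
        real_inner_smul_right]
      simp only [mul_one, Real.norm_eq_abs, sq_abs]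
      have : 0 ≤ w p * w q * r p q := mul_nonneg_of_nonpos_of_nonpos hneg.le hrneg
      simp only [hr] at this
      nlinarith
    have hnB : ‖B‖ ^ 2 ≤ n * R := by
      have h1 : ‖B‖ ≤ ∑ k ∈ (Finset.univ.erase p).erase q, |w k| := by
        refine (norm_sum_le _ _).trans_eq (Finset.sum_congr rfl fun k _ => ?_)
        rw [norm_smul, hx, mul_one, Real.norm_eq_abs]
      have h2 := sq_sum_le_card_mul_sum_sq (s := (Finset.univ.erase p).erase q)
        (f := fun k => |w k|)
      simp only [sq_abs] at h2
      have h3 : ((((Finset.univ.erase p).erase q).card : ℕ) : ℝ) ≤ n := by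
        have : ((Finset.univ.erase p).erase q).card ≤ Fintype.card ι := Finset.card_le_univ _
        rw [hn]
        have : ((((Finset.univ.erase p).erase q).card : ℕ) : ℝ) ≤ Fintype.card ι := by
          exact_mod_cast this
        linarith
      calc ‖B‖ ^ 2 ≤ (∑ k ∈ (Finset.univ.erase p).erase q, |w k|) ^ 2 := by gcongr
        _ ≤ _ := h2
        _ ≤ n * R := by gcongr
    have hpar : ‖A‖ ^ 2 ≤ 2 * ‖A + B‖ ^ 2 + 2 * ‖B‖ ^ 2 := by
      have h1 : ‖A‖ ≤ ‖A + B‖ + ‖B‖ := by simpa using norm_sub_le (A + B) B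
      nlinarith [sq_nonneg (‖A + B‖ - ‖B‖), norm_nonneg A, norm_nonneg B, norm_nonneg (A + B)]
    rw [hQ₁, quadForm_layerMatrix_zero hx, hAB]
    linarith
  have hn0 : 0 < 1 / n := by positivity
  have hn1' : 1 / n ≤ 1 := by rw [div_le_one (by positivity)]; exact hn1
  have e8 : 1 / (8 * n) = 1 / n / 8 := by field_simp
  have hnn : 1 / n * n = 1 := by field_simp
  -- With weight `1 / (2n)` the error `n * R` becomes `R / 2`, which fits into the full `R` left in
  -- `Q₂`.
  have hsc : 1 / n / 2 * ((w p ^ 2 + w q ^ 2) / 2 - n * R) ≤ Q₁ := by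
    refine (mul_le_mul_of_nonneg_left hQ₁low (by positivity)).trans ?_
    exact mul_le_of_le_one_left p1 (by linarith)
  have e9 : 1 / n / 2 * ((w p ^ 2 + w q ^ 2) / 2 - n * R) =
      1 / n * (w p ^ 2 + w q ^ 2) / 4 - R / 2 := by
    field_simp
    ring
  rw [e9] at hsc
  rw [e8] at hβs ⊢
  rw [hP₀'] at hQ₂low
  have hRn : 1 / n * R ≤ R := mul_le_of_le_one_left hR0 hn1'
  have hsq := sq_nonneg (w p + w q)
  have hWn : W * (1 / n / 8) = 1 / n * (w p ^ 2 + w q ^ 2) / 8 + 1 / n * R / 8 := by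
    rw [hWR]; ring
  rw [hWn] at hβs
  rw [mul_comm, hWn]
  linarith

end KernelMatrices

/-! ### Variational bounds for eigenvalues -/

section Spectral

variable {ι : Type*} [Fintype ι] [DecidableEq ι]

/-- A spectral decomposition of a symmetric matrix in coordinates. -/
lemma exists_spectral_decomposition {S : Matrix ι ι ℝ} (hS : S.IsHermitian) :
    ∃ (ev : ι → ℝ) (V : ι → ι → ℝ), (∀ e f, V e ⬝ᵥ V f = if e = f then 1 else 0) ∧
      (∀ e, S *ᵥ V e = ev e • V e) ∧
      (∀ u : ι → ℝ, u ⬝ᵥ u = ∑ e, (V e ⬝ᵥ u) ^ 2) ∧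
      (∀ u : ι → ℝ, u ⬝ᵥ (S *ᵥ u) = ∑ e, ev e * (V e ⬝ᵥ u) ^ 2) := by
  have hortho : ∀ e f, (⇑(hS.eigenvectorBasis e) : ι → ℝ) ⬝ᵥ ⇑(hS.eigenvectorBasis f) =
      if e = f then 1 else 0 := by
    intro e f
    have h := orthonormal_iff_ite.1 hS.eigenvectorBasis.orthonormal f e
    rw [EuclideanSpace.inner_eq_star_dotProduct] at h
    simp only [star_trivial, eq_comm (a := f)] at h
    exact h
  have hexp : ∀ u : ι → ℝ, u = ∑ e, ((⇑(hS.eigenvectorBasis e) : ι → ℝ) ⬝ᵥ u) •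
      (⇑(hS.eigenvectorBasis e) : ι → ℝ) := by
    intro u
    have h := hS.eigenvectorBasis.sum_repr' (WithLp.toLp 2 u)
    have h2 := congrArg WithLp.ofLp h
    rw [WithLp.ofLp_sum] at h2
    simp only [WithLp.ofLp_smul] at h2
    rw [← h2]
    refine Finset.sum_congr rfl fun e _ => ?_
    congr 1
    rw [EuclideanSpace.inner_eq_star_dotProduct]
    simp only [star_trivial]
    rw [h2, dotProduct_comm]
  refine ⟨hS.eigenvalues, fun e => ⇑(hS.eigenvectorBasis e), hortho,
    fun e => hS.mulVec_eigenvectorBasis e, fun u => ?_, fun u => ?_⟩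
  · conv_lhs => rw [hexp u]
    rw [sum_dotProduct]
    conv_lhs => enter [2, e]; rw [← hexp u]
    refine Finset.sum_congr rfl fun e _ => ?_
    rw [smul_dotProduct, smul_eq_mul, sq]
  · have h : ∀ e, (⇑(hS.eigenvectorBasis e) : ι → ℝ) ⬝ᵥ (S *ᵥ u) =
        hS.eigenvalues e * ((⇑(hS.eigenvectorBasis e) : ι → ℝ) ⬝ᵥ u) := by
      intro e
      have hT : Sᵀ = S := by simpa using hS.eq
      rw [dotProduct_mulVec, ← mulVec_transpose, hT, hS.mulVec_eigenvectorBasis,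
        smul_dotProduct, smul_eq_mul]
    conv_lhs => rw [hexp u]
    rw [sum_dotProduct]
    conv_lhs => enter [2, e]; rw [← hexp u]
    refine Finset.sum_congr rfl fun e _ => ?_
    rw [smul_dotProduct, h, smul_eq_mul]
    ring

/-- Rayleigh's bound for the smallest eigenvalue. -/
lemma exists_eigenvector_of_rayleigh {S : Matrix ι ι ℝ} (hS : S.PosSemidef) {B : ℝ}
    {u : ι → ℝ} (hu : u ≠ 0) (hB : u ⬝ᵥ (S *ᵥ u) ≤ B * (u ⬝ᵥ u)) :
    ∃ (lam : ℝ) (v : ι → ℝ), 0 ≤ lam ∧ lam ≤ B ∧ v ⬝ᵥ v = 1 ∧ S *ᵥ v = lam • v := by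
  obtain ⟨ev, V, horth, heig, hsq, hform⟩ := exists_spectral_decomposition hS.isHermitian
  have hex : ∃ e, ev e ≤ B := by
    by_contra! h
    have hpos : 0 < ∑ e, (V e ⬝ᵥ u) ^ 2 := by
      rw [← hsq]
      have h0 : 0 ≤ u ⬝ᵥ u := by rw [hsq]; positivity
      exact lt_of_le_of_ne h0 fun h0 => hu (dotProduct_self_eq_zero.1 h0.symm)
    obtain ⟨e, -, he⟩ : ∃ e ∈ Finset.univ, 0 < (V e ⬝ᵥ u) ^ 2 :=
      Finset.exists_lt_of_sum_lt (by simpa using hpos)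
    rw [hform, hsq, Finset.mul_sum] at hB
    refine absurd hB (not_le.2 (Finset.sum_lt_sum (fun f _ => ?_) ⟨e, Finset.mem_univ e, ?_⟩))
    · exact mul_le_mul_of_nonneg_right (h f).le (sq_nonneg _)
    · exact mul_lt_mul_of_pos_right (h e) he
  obtain ⟨e, he⟩ := hex
  have h1 : V e ⬝ᵥ V e = 1 := by rw [horth, if_pos rfl]
  refine ⟨ev e, V e, ?_, he, h1, heig e⟩
  have h2 := (posSemidef_iff_quadForm.1 hS).2 (V e)
  rw [quadForm_eq_dotProduct, heig, dotProduct_smul, h1] at h2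
  simpa using h2

/-- The second smallest eigenvalue: an upper bound from a two-dimensional test space, and a vector
in the kernel of a given functional on which the matrix is no larger than the eigenvalue. -/
lemma exists_eigenvector_of_plane {S : Matrix ι ι ℝ} (hS : S.PosSemidef) {B : ℝ}
    {u₁ u₂ : ι → ℝ} (hu : ∀ α β : ℝ, α • u₁ + β • u₂ = 0 → α = 0 ∧ β = 0)
    (hB : ∀ α β : ℝ, (α • u₁ + β • u₂) ⬝ᵥ (S *ᵥ (α • u₁ + β • u₂)) ≤
      B * ((α • u₁ + β • u₂) ⬝ᵥ (α • u₁ + β • u₂))) (f : (ι → ℝ) →ₗ[ℝ] ℝ) :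
    ∃ (lam : ℝ) (v u : ι → ℝ), 0 ≤ lam ∧ lam ≤ B ∧ v ⬝ᵥ v = 1 ∧ S *ᵥ v = lam • v ∧
      u ⬝ᵥ u = 1 ∧ f u = 0 ∧ (S *ᵥ u) ⬝ᵥ (S *ᵥ u) ≤ lam ^ 2 := by
  obtain ⟨ev, V, horth, heig, hsq, hform⟩ := exists_spectral_decomposition hS.isHermitian
  have hnn : ∀ e, 0 ≤ ev e := by
    intro e
    have h2 := (posSemidef_iff_quadForm.1 hS).2 (V e)
    rw [quadForm_eq_dotProduct, heig, dotProduct_smul, horth, if_pos rfl] at h2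
    simpa using h2
  have hline : ∀ a b : ℝ, ∃ α β : ℝ, (α ≠ 0 ∨ β ≠ 0) ∧ α * a + β * b = 0 := by
    intro a b
    by_cases h : a = 0 ∧ b = 0
    · exact ⟨1, 0, Or.inl one_ne_zero, by simp [h.1]⟩
    · refine ⟨b, -a, ?_, by ring⟩
      by_contra! h2
      exact h ⟨neg_eq_zero.1 h2.2, h2.1⟩
  have hne : Nonempty ι := by
    by_contra h
    rw [not_nonempty_iff] at h
    exact one_ne_zero (hu 1 0 (Subsingleton.elim _ _)).1
  obtain ⟨e₀, -, he₀⟩ := Finset.exists_min_image Finset.univ ev Finset.univ_nonempty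
  -- The test plane contains a nonzero vector orthogonal to the lowest eigenvector; were all other
  -- eigenvalues above `B`, its Rayleigh quotient would be too.
  have hex : ∃ e, e ≠ e₀ ∧ ev e ≤ B := by
    by_contra! h
    obtain ⟨α, β, hαβ, h0⟩ := hline (V e₀ ⬝ᵥ u₁) (V e₀ ⬝ᵥ u₂)
    set u := α • u₁ + β • u₂ with hu'
    have hune : u ≠ 0 := fun h0 => by
      have := hu α β h0
      tauto
    have hu0 : V e₀ ⬝ᵥ u = 0 := by
      rw [hu', dotProduct_add, dotProduct_smul, dotProduct_smul, smul_eq_mul, smul_eq_mul, h0]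
    have hpos : 0 < ∑ e, (V e ⬝ᵥ u) ^ 2 := by
      rw [← hsq]
      have h0 : 0 ≤ u ⬝ᵥ u := by rw [hsq]; positivity
      exact lt_of_le_of_ne h0 fun h0 => hune (dotProduct_self_eq_zero.1 h0.symm)
    obtain ⟨e, -, he⟩ : ∃ e ∈ Finset.univ, 0 < (V e ⬝ᵥ u) ^ 2 :=
      Finset.exists_lt_of_sum_lt (by simpa using hpos)
    have hBu := hB α β
    rw [← hu', hform, hsq, Finset.mul_sum] at hBu
    refine absurd hBu (not_le.2 (Finset.sum_lt_sum (fun g _ => ?_) ⟨e, Finset.mem_univ e, ?_⟩))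
    · by_cases hg : g = e₀
      · rw [hg, hu0]; simp
      · exact mul_le_mul_of_nonneg_right (h g hg).le (sq_nonneg _)
    · have hne : e ≠ e₀ := fun h => by simp [h, hu0] at he
      exact mul_lt_mul_of_pos_right (h e hne) he
  obtain ⟨e, hee, he⟩ := hex
  have h1 : V e ⬝ᵥ V e = 1 := by rw [horth, if_pos rfl]
  have h2 : V e₀ ⬝ᵥ V e₀ = 1 := by rw [horth, if_pos rfl]
  have h3 : V e ⬝ᵥ V e₀ = 0 := by rw [horth, if_neg hee]
  have h4 : V e₀ ⬝ᵥ V e = 0 := by rw [horth, if_neg (Ne.symm hee)]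
  -- `f` vanishes on some line in the span of the two eigenvectors, and on this span the matrix has
  -- norm `ev e`.
  obtain ⟨α, β, hαβ, h0⟩ := hline (f (V e)) (f (V e₀))
  have hN : 0 < α ^ 2 + β ^ 2 := by
    rcases hαβ with h | h <;> positivity
  set N := √(α ^ 2 + β ^ 2) with hNdef
  have hN0 : 0 < N := Real.sqrt_pos.2 hN
  have hN2 : N ^ 2 = α ^ 2 + β ^ 2 := Real.sq_sqrt hN.le
  have hsum : (α / N) ^ 2 + (β / N) ^ 2 = 1 := by
    rw [div_pow, div_pow, ← add_div, ← hN2, div_self (by positivity)]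
  refine ⟨ev e, V e, (α / N) • V e + (β / N) • V e₀, hnn e, he, h1, heig e, ?_, ?_, ?_⟩
  · simp only [dotProduct_add, add_dotProduct, smul_dotProduct, dotProduct_smul, smul_eq_mul, h1,
      h2, h3, h4]
    linarith
  · rw [map_add, map_smul, map_smul, smul_eq_mul, smul_eq_mul]
    have : α / N * f (V e) + β / N * f (V e₀) = (α * f (V e) + β * f (V e₀)) / N := by ring
    rw [this, h0, zero_div]
  · rw [mulVec_add, mulVec_smul, mulVec_smul, heig, heig]
    simp only [dotProduct_add, add_dotProduct, smul_dotProduct, dotProduct_smul, smul_eq_mul, h1,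
      h2, h3, h4]
    have hle : ev e₀ ^ 2 ≤ ev e ^ 2 := pow_le_pow_left₀ (hnn e₀) (he₀ e (Finset.mem_univ e)) 2
    have := mul_le_mul_of_nonneg_left hle (sq_nonneg (β / N))
    have e1 : ev e ^ 2 = ((α / N) ^ 2 + (β / N) ^ 2) * ev e ^ 2 := by rw [hsum, one_mul]
    linarith

end Spectral

/-! ### The dual estimate for dipoles and a coercive remainder -/

section Dipoles

variable {ι : Type*} [Fintype ι]

lemma abs_sum_mul_le {u w : ι → ℝ} {B : ℝ} (h : ∀ k, |u k| ≤ B) :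
    |∑ k, u k * w k| ≤ B * ∑ k, |w k| := by
  refine (Finset.abs_sum_le_sum_abs _ _).trans ?_
  rw [Finset.mul_sum]
  refine Finset.sum_le_sum fun k _ => ?_
  rw [abs_mul]
  exact mul_le_mul_of_nonneg_right (h k) (abs_nonneg _)

/-- A coercive quadratic form bounds the `ℓ¹` norm by the supremum norm of the image. -/
lemma sum_abs_le_of_coercive {K : Matrix ι ι ℝ} {w : ι → ℝ} {μ B : ℝ} (hμ : 0 < μ)
    (hB : ∀ k, |(K *ᵥ w) k| ≤ B) (hc : μ * ∑ k, w k ^ 2 ≤ quadForm K w) :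
    ∑ k, |w k| ≤ Fintype.card ι / μ * B := by
  set T := ∑ k, |w k| with hT
  have hT0 : 0 ≤ T := Finset.sum_nonneg fun k _ => abs_nonneg _
  have h1 : T ^ 2 ≤ Fintype.card ι * ∑ k, w k ^ 2 := by
    have h := sq_sum_le_card_mul_sum_sq (s := Finset.univ) (f := fun k => |w k|)
    simpa only [sq_abs, Finset.card_univ] using h
  have h2 : quadForm K w ≤ B * T := by
    rw [quadForm_eq_dotProduct, dotProduct_comm]
    exact (le_abs_self _).trans (abs_sum_mul_le hB)
  rcases hT0.eq_or_lt with h0 | h0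
  · rw [← h0]
    rcases isEmpty_or_nonempty ι with h | ⟨⟨k⟩⟩
    · simp
    · have := (abs_nonneg _).trans (hB k)
      positivity
  · have h3 : μ * T * T ≤ Fintype.card ι * B * T := by
      have : (Fintype.card ι : ℝ) * (μ * ∑ k, w k ^ 2) ≤ Fintype.card ι * (B * T) :=
        mul_le_mul_of_nonneg_left (hc.trans h2) (Nat.cast_nonneg _)
      nlinarith
    have h4 := le_of_mul_le_mul_right h3 h0
    rw [div_mul_eq_mul_div, le_div_iff₀ hμ]
    linarith

variable [DecidableEq ι]

/-- Dual estimate for a kernel matrix with a cluster `p, q, r` of close inputs: a vector `w`,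
decomposed into two dipoles and a vector `w'` on which the kernel is coercive, pairs with Lipschitz
labels within a constant multiple of the supremum norm of `K w`. -/
lemma abs_dotProduct_le_of_dipoles {K : Matrix ι ι ℝ} (hsym : ∀ k l, K k l = K l k)
    {p q r : ι} {a b Λ μ c₁ c₂ Ly M F α β : ℝ} {w w' y : ι → ℝ}
    (ha : 0 ≤ a) (hb : 0 ≤ b) (hΛ : 0 < Λ) (hμ : 0 < μ) (hc₂ : 0 ≤ c₂) (hc : c₂ < c₁)
    (hLy : 0 ≤ Ly) (hM : 0 ≤ M)
    (hKp : ∀ m, |K p m - K r m| ≤ Λ * a) (hKq : ∀ m, |K q m - K r m| ≤ Λ * b)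
    (hpp : c₁ * a ≤ K p p - 2 * K p r + K r r)
    (hβ : β = 0 ∨ (a ≤ b ∧ c₁ * b ≤ K q q - 2 * K q r + K r r ∧
      |K p q - K p r - K q r + K r r| ≤ c₂ * a))
    (hw : w = w' + α • (Pi.single p 1 - Pi.single r 1) + β • (Pi.single q 1 - Pi.single r 1))
    (hcoer : μ * ∑ k, w' k ^ 2 ≤ quadForm K w')
    (hsmall : Λ ^ 2 * (a + b) * (Fintype.card ι / μ) ≤ (c₁ - c₂) / 2)
    (hF : ∀ k, |(K *ᵥ w) k| ≤ F)
    (hyM : ∀ k, |y k| ≤ M) (hyp : |y p - y r| ≤ Ly * a) (hyq : |y q - y r| ≤ Ly * b) :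
    |w ⬝ᵥ y| ≤ (M * (Fintype.card ι / μ * (1 + Λ * (8 / (c₁ - c₂) + 1 / Λ))) +
      Ly * (8 / (c₁ - c₂) + 1 / Λ)) * F := by
  have hF0 : 0 ≤ F := (abs_nonneg _).trans (hF p)
  set ν : ℝ := Fintype.card ι / μ with hν
  have hν0 : 0 ≤ ν := by positivity
  set T := ∑ k, |w' k| with hT
  have hT0 : 0 ≤ T := Finset.sum_nonneg fun k _ => abs_nonneg _
  set P := a * |α| with hP
  set Q := b * |β| with hQ
  have hP0 : 0 ≤ P := by positivity
  have hQ0 : 0 ≤ Q := by positivity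
  have hKw : ∀ k, (K *ᵥ w) k = (K *ᵥ w') k + α * (K k p - K k r) + β * (K k q - K k r) := by
    intro k
    rw [hw, mulVec_add, mulVec_add, mulVec_smul, mulVec_smul, mulVec_sub, mulVec_sub]
    simp
  have hdiff : ∀ s : ι, ∀ e : ℝ, (∀ m, |K s m - K r m| ≤ Λ * e) →
      |(K *ᵥ w') s - (K *ᵥ w') r| ≤ Λ * e * T := by
    intro s e h
    have : (K *ᵥ w') s - (K *ᵥ w') r = ∑ m, (K s m - K r m) * w' m := by
      simp only [mulVec, dotProduct, ← Finset.sum_sub_distrib, sub_mul]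
    rw [this]
    exact abs_sum_mul_le h
  have hFd : ∀ s, |(K *ᵥ w) s - (K *ᵥ w) r| ≤ 2 * F := fun s =>
    (abs_sub _ _).trans (by linarith [hF s, hF r])
  -- Testing `K w` against the dipole at `p` isolates `α` times its energy. Measured in the moments
  -- `P = a |α|` and `Q = b |β|`, the two dipole equations form a diagonally dominant system.
  have rowp : c₁ * P ≤ c₂ * Q + 2 * F + Λ * a * T := by
    have e : α * (K p p - 2 * K p r + K r r) = ((K *ᵥ w) p - (K *ᵥ w) r) -
        ((K *ᵥ w') p - (K *ᵥ w') r) - β * (K p q - K p r - K q r + K r r) := by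
      rw [hKw p, hKw r, hsym r p, hsym r q]
      ring
    have h1 : c₁ * P ≤ |α * (K p p - 2 * K p r + K r r)| := by
      rw [abs_mul]
      have := le_abs_self (K p p - 2 * K p r + K r r)
      have := mul_le_mul_of_nonneg_left (hpp.trans this) (abs_nonneg α)
      rw [hP]
      linarith
    have h2 : |β * (K p q - K p r - K q r + K r r)| ≤ c₂ * Q := by
      rcases hβ with h | ⟨hab, -, h⟩
      · rw [hQ, h]; simp
      · rw [abs_mul]
        have h3 := mul_le_mul_of_nonneg_left h (abs_nonneg β)
        have h4 := mul_le_mul_of_nonneg_left hab (mul_nonneg hc₂ (abs_nonneg β))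
        rw [hQ]
        linarith
    rw [e] at h1
    have h3 := abs_sub (((K *ᵥ w) p - (K *ᵥ w) r) - ((K *ᵥ w') p - (K *ᵥ w') r))
      (β * (K p q - K p r - K q r + K r r))
    have h4 := abs_sub ((K *ᵥ w) p - (K *ᵥ w) r) ((K *ᵥ w') p - (K *ᵥ w') r)
    linarith [hFd p, hdiff p a hKp]
  have rowq : c₁ * Q ≤ c₂ * P + 2 * F + Λ * b * T := by
    rcases hβ with h | ⟨hab, hqq, hpq⟩
    · have : Q = 0 := by rw [hQ, h]; simp
      rw [this]
      have : 0 ≤ Λ * b * T := by positivity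
      nlinarith
    have e : β * (K q q - 2 * K q r + K r r) = ((K *ᵥ w) q - (K *ᵥ w) r) -
        ((K *ᵥ w') q - (K *ᵥ w') r) - α * (K p q - K p r - K q r + K r r) := by
      rw [hKw q, hKw r, hsym r p, hsym r q, hsym q p]
      ring
    have h1 : c₁ * Q ≤ |β * (K q q - 2 * K q r + K r r)| := by
      rw [abs_mul]
      have := le_abs_self (K q q - 2 * K q r + K r r)
      have := mul_le_mul_of_nonneg_left (hqq.trans this) (abs_nonneg β)
      rw [hQ]
      linarith
    have h2 : |α * (K p q - K p r - K q r + K r r)| ≤ c₂ * P := by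
      rw [abs_mul]
      have h3 := mul_le_mul_of_nonneg_left hpq (abs_nonneg α)
      rw [hP]
      linarith
    rw [e] at h1
    have h3 := abs_sub (((K *ᵥ w) q - (K *ᵥ w) r) - ((K *ᵥ w') q - (K *ᵥ w') r))
      (α * (K p q - K p r - K q r + K r r))
    have h4 := abs_sub ((K *ᵥ w) q - (K *ᵥ w) r) ((K *ᵥ w') q - (K *ᵥ w') r)
    linarith [hFd q, hdiff q b hKq]
  set V := P + Q with hV
  have hV0 : 0 ≤ V := by positivity
  have hT1 : T ≤ ν * (F + Λ * V) := by
    refine sum_abs_le_of_coercive hμ (fun k => ?_) hcoer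
    have e : (K *ᵥ w') k = (K *ᵥ w) k - α * (K k p - K k r) - β * (K k q - K k r) := by
      rw [hKw k]; ring
    have h1 : |α * (K k p - K k r)| ≤ Λ * P := by
      rw [abs_mul, hsym k p, hsym k r, hP]
      have := mul_le_mul_of_nonneg_left (hKp k) (abs_nonneg α)
      linarith
    have h2 : |β * (K k q - K k r)| ≤ Λ * Q := by
      rw [abs_mul, hsym k q, hsym k r, hQ]
      have := mul_le_mul_of_nonneg_left (hKq k) (abs_nonneg β)
      linarith
    rw [e]
    have h3 := abs_sub ((K *ᵥ w) k - α * (K k p - K k r)) (β * (K k q - K k r))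
    have h4 := abs_sub ((K *ᵥ w) k) (α * (K k p - K k r))
    rw [hV]
    linarith [hF k]
  set γ := c₁ - c₂ with hγ
  have hγ0 : 0 < γ := sub_pos.2 hc
  -- Adding the rows gives `γ V ≤ 4 F + Λ (a + b) T`, while `T` is bounded by `F + Λ V`. The
  -- smallness of `a + b` absorbs the term in `V` into half of the left side.
  have hVF : V ≤ (8 / γ + 1 / Λ) * F := by
    have h1 : γ * V ≤ 4 * F + Λ * (a + b) * T := by
      rw [hγ, hV]; linarith
    have h2 : Λ * (a + b) * T ≤ Λ * (a + b) * (ν * (F + Λ * V)) := by gcongr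
    have h3 : Λ * (a + b) * (ν * (F + Λ * V)) =
        Λ ^ 2 * (a + b) * ν * (F / Λ) + Λ ^ 2 * (a + b) * ν * V := by
      field_simp
    have h4 : Λ ^ 2 * (a + b) * ν * (F / Λ) ≤ γ / 2 * (F / Λ) := by gcongr
    have h5 : Λ ^ 2 * (a + b) * ν * V ≤ γ / 2 * V := by gcongr
    have h6 : γ / 2 * V ≤ γ / 2 * ((8 / γ + 1 / Λ) * F) := by
      have : γ / 2 * ((8 / γ + 1 / Λ) * F) = 4 * F + γ / 2 * (F / Λ) := by
        field_simp
        ring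
      rw [this]
      linarith
    exact le_of_mul_le_mul_left h6 (by positivity)
  have hy : w ⬝ᵥ y = ∑ k, y k * w' k + α * (y p - y r) + β * (y q - y r) := by
    rw [hw, add_dotProduct, add_dotProduct, smul_dotProduct, smul_dotProduct, sub_dotProduct,
      sub_dotProduct]
    simp only [single_one_dotProduct, smul_eq_mul]
    congr 2
    exact Finset.sum_congr rfl fun k _ => mul_comm _ _
  have h1 : |α * (y p - y r)| ≤ Ly * P := by
    rw [abs_mul, hP]
    have := mul_le_mul_of_nonneg_left hyp (abs_nonneg α)
    linarith
  have h2 : |β * (y q - y r)| ≤ Ly * Q := by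
    rw [abs_mul, hQ]
    have := mul_le_mul_of_nonneg_left hyq (abs_nonneg β)
    linarith
  have h3 : |∑ k, y k * w' k| ≤ M * T := abs_sum_mul_le hyM
  have h4 : M * T ≤ M * (ν * (F + Λ * ((8 / γ + 1 / Λ) * F))) := by
    refine mul_le_mul_of_nonneg_left (hT1.trans ?_) hM
    gcongr
  have h5 : Ly * V ≤ Ly * ((8 / γ + 1 / Λ) * F) := by gcongr
  rw [hy]
  refine (abs_add_three _ _ _).trans ?_
  rw [hV] at h5
  linarith

end Dipoles

open InnerProductGeometry

/-! ### Angles, chords and the local slope of the profile -/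

section Geometry

variable {ι : Type*} {d : ℕ}

lemma norm_sub_eq_two_mul_sin {x x' : EuclideanSpace ℝ (Fin d)} (hx : ‖x‖ = 1) (hx' : ‖x'‖ = 1) :
    ‖x - x'‖ = 2 * Real.sin (angle x x' / 2) := by
  have h0 := angle_nonneg x x'
  have h1 := angle_le_pi x x'
  have hs : 0 ≤ Real.sin (angle x x' / 2) :=
    Real.sin_nonneg_of_nonneg_of_le_pi (by linarith) (by linarith [Real.pi_pos])
  have h2 : ‖x - x'‖ ^ 2 = (2 * Real.sin (angle x x' / 2)) ^ 2 := by
    have hc : inner ℝ x x' = Real.cos (angle x x') := by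
      rw [cos_angle, hx, hx']; simp
    rw [norm_sub_sq_real, hx, hx', hc, mul_pow, Real.sin_sq_eq_half_sub]
    ring_nf
  exact (pow_left_inj₀ (norm_nonneg _) (by positivity) two_ne_zero).1 h2

lemma norm_sub_le_angle {x x' : EuclideanSpace ℝ (Fin d)} (hx : ‖x‖ = 1) (hx' : ‖x'‖ = 1) :
    ‖x - x'‖ ≤ angle x x' := by
  rw [norm_sub_eq_two_mul_sin hx hx']
  have := Real.sin_le (show 0 ≤ angle x x' / 2 by linarith [angle_nonneg x x'])
  linarith

lemma angle_le_norm_sub {x x' : EuclideanSpace ℝ (Fin d)} (hx : ‖x‖ = 1) (hx' : ‖x'‖ = 1) :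
    2 / Real.pi * angle x x' ≤ ‖x - x'‖ := by
  rw [norm_sub_eq_two_mul_sin hx hx']
  have := Real.mul_le_sin (show 0 ≤ angle x x' / 2 by linarith [angle_nonneg x x'])
    (by linarith [angle_le_pi x x'])
  linarith

/-- The angle satisfies the triangle inequality, so the distance to a third input changes by at most
the angle between the first two. -/
lemma abs_profileMatrix_sub_le {L : ℕ} {Λ : ℝ}
    (hΛ : ∀ s t : ℝ, 0 ≤ s → s ≤ Real.pi → 0 ≤ t → t ≤ Real.pi →
      |ntkProfile L t - ntkProfile L s| ≤ Λ * |t - s|) (hΛ0 : 0 ≤ Λ)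
    (x : ι → EuclideanSpace ℝ (Fin d)) (k l m : ι) :
    |profileMatrix L x k m - profileMatrix L x l m| ≤ Λ * angle (x k) (x l) := by
  refine (hΛ _ _ (angle_nonneg _ _) (angle_le_pi _ _) (angle_nonneg _ _) (angle_le_pi _ _)).trans
    (mul_le_mul_of_nonneg_left ?_ hΛ0)
  rw [abs_le]
  have h1 := angle_le_angle_add_angle (x k) (x l) (x m)
  have h2 := angle_le_angle_add_angle (x l) (x k) (x m)
  rw [angle_comm (x l) (x k)] at h2
  constructor <;> linarith

lemma profileMatrix_comm (L : ℕ) (x : ι → EuclideanSpace ℝ (Fin d)) (k l : ι) :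
    profileMatrix L x k l = profileMatrix L x l k := by
  simp [profileMatrix, angle_comm]

lemma profileMatrix_self (L : ℕ) {x : ι → EuclideanSpace ℝ (Fin d)} (hx : ∀ k, ‖x k‖ = 1) (k : ι) :
    profileMatrix L x k k = ntkProfile L 0 := by
  have : x k ≠ 0 := fun h => by simpa [h] using hx k
  simp only [profileMatrix, of_apply, angle_self this]

lemma abs_inner_le_cos {x x' : EuclideanSpace ℝ (Fin d)} (hx : ‖x‖ = 1) (hx' : ‖x'‖ = 1) {δ : ℝ}
    (hδ : 0 ≤ δ) (h1 : δ ≤ angle x x') (h2 : angle x x' ≤ Real.pi - δ) :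
    |inner ℝ x x'| ≤ Real.cos δ := by
  have hc : inner ℝ x x' = Real.cos (angle x x') := by
    rw [cos_angle, hx, hx']; simp
  rw [hc, abs_le]
  constructor
  · rw [← Real.cos_pi_sub]
    exact Real.cos_le_cos_of_nonneg_of_le_pi (angle_nonneg _ _) (by linarith) h2
  · exact Real.cos_le_cos_of_nonneg_of_le_pi hδ (angle_le_pi _ _) h1

lemma inner_nonpos_of_angle {x x' : EuclideanSpace ℝ (Fin d)}
    (h : Real.pi / 2 ≤ angle x x') : inner ℝ x x' ≤ 0 := by
  rw [← cos_angle_mul_norm_mul_norm]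
  refine mul_nonpos_of_nonpos_of_nonneg ?_ (by positivity)
  exact Real.cos_nonpos_of_pi_div_two_le_of_le h (by linarith [angle_le_pi x x', Real.pi_pos])

/-- Ten percent accuracy suffices: only `11/10 < 2 · 9/10` is needed, so that dipole energies
dominate their interaction. -/
lemma exists_ntkProfile_slope {L : ℕ} (hL : 1 ≤ L) :
    ∃ c₀ η : ℝ, 0 < c₀ ∧ 0 < η ∧ ∀ s t : ℝ, 0 ≤ s → s ≤ t → t ≤ η →
      9 / 10 * c₀ * (t - s) ≤ ntkProfile L s - ntkProfile L t ∧
        ntkProfile L s - ntkProfile L t ≤ 11 / 10 * c₀ * (t - s) := by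
  have hpi := Real.pi_pos
  have hL' : (1 : ℝ) ≤ L := by exact_mod_cast hL
  set c₀ : ℝ := L * (L + 1) / (2 * Real.pi) with hc₀
  have hc : 0 < c₀ := by positivity
  obtain ⟨η, hη, h⟩ := hasStrictRightDeriv_ntkProfile L (c₀ / 10) (by positivity)
  refine ⟨c₀, η, hc, hη, fun s t h0 hst ht => ?_⟩
  have := abs_le.1 (h s t h0 hst ht)
  rw [← hc₀] at this
  constructor <;> linarith [this.1, this.2]

/-- Three points can be labelled such that their mutual distances are sorted. -/
lemma exists_sorted_triple [DecidableEq ι] (D : ι → ι → ℝ) (hD : ∀ k l, D k l = D l k) {i j k : ι}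
    (hij : i ≠ j) (hik : i ≠ k) (hjk : j ≠ k) :
    ∃ p q r : ι, p ≠ q ∧ p ≠ r ∧ q ≠ r ∧ D p r ≤ D q r ∧ D q r ≤ D p q ∧
      ({p, q, r} : Finset ι) = {i, j, k} := by
  rcases le_total (D i j) (D i k) with h1 | h1 <;> rcases le_total (D i j) (D j k) with h2 | h2 <;>
    rcases le_total (D i k) (D j k) with h3 | h3
  · exact ⟨j, k, i, hjk, hij.symm, hik.symm, by rw [hD j i, hD k i]; exact h1,
      by rw [hD k i]; exact h3, by ext; simp; tauto⟩
  · exact ⟨i, k, j, hik, hij, hjk.symm, by rw [hD k j]; exact h2,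
      by rw [hD k j]; exact h3, by ext; simp; tauto⟩
  · exact ⟨j, k, i, hjk, hij.symm, hik.symm, by rw [hD j i, hD k i]; exact h1,
      by rw [hD k i]; exact h3, by ext; simp; tauto⟩
  · exact ⟨k, i, j, hik.symm, hjk.symm, hij, by rw [hD k j]; exact h2,
      by rw [hD k i]; exact h1, by ext; simp; tauto⟩
  · exact ⟨k, j, i, hjk.symm, hik.symm, hij.symm, by rw [hD k i, hD j i]; exact h1,
      by rw [hD j i, hD k j]; exact h2, by ext; simp; tauto⟩
  · exact ⟨j, i, k, hij.symm, hjk, hik, h3, by rw [hD j i]; exact h1, by ext; simp; tauto⟩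
  · exact ⟨i, j, k, hij, hik, hjk, h3, by exact h2, by ext; simp⟩
  · exact ⟨j, i, k, hij.symm, hjk, hik, h3, by rw [hD j i]; exact h1, by ext; simp; tauto⟩

end Geometry

/-! ### The label bound, uniform in the position of the close pair -/

section LabelBound

variable {ι : Type*} [Fintype ι] [DecidableEq ι] {d : ℕ}

/-- The label bound for a cluster of three close inputs. -/
lemma exists_label_bound_of_cluster {L : ℕ} (hL : 1 ≤ L) {δ Ly M : ℝ} (hδ : 0 < δ)
    (hδ2 : δ ≤ Real.pi / 2) (hLy : 0 < Ly) (hM : 0 < M) :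
    ∃ ω C : ℝ, 0 < ω ∧ 0 < C ∧ ∀ x : ι → EuclideanSpace ℝ (Fin d), (∀ k, ‖x k‖ = 1) →
      ∀ p q r : ι, p ≠ q → p ≠ r → q ≠ r → angle (x p) (x r) ≤ angle (x q) (x r) →
      angle (x q) (x r) ≤ angle (x p) (x q) → angle (x p) (x q) ≤ ω →
      (∀ k l, k ≠ l → k ≠ p → k ≠ q → l ≠ p → l ≠ q →
        δ ≤ angle (x k) (x l) ∧ angle (x k) (x l) ≤ Real.pi - δ) →
      ∀ (w y : ι → ℝ) (F : ℝ), (∀ k l, |y k - y l| ≤ Ly * angle (x k) (x l)) →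
        (∀ k, |y k| ≤ M) → (∀ k, |(profileMatrix L x *ᵥ w) k| ≤ F) → |w ⬝ᵥ y| ≤ C * F := by
  have hpi := Real.pi_pos
  obtain ⟨c₀, η, hc₀, hη, hslope⟩ := exists_ntkProfile_slope hL
  obtain ⟨Λ, hΛ, hlip⟩ := exists_ntkProfile_lipschitz L
  obtain ⟨μ, hμ, hcoer⟩ := exists_coercive (ι := ι) (d := d) hL
    (Real.cos_nonneg_of_neg_pi_div_two_le_of_le (by linarith) hδ2)
    (show Real.cos δ < 1 by
      rw [← Real.cos_zero]
      exact Real.cos_lt_cos_of_nonneg_of_le_pi_div_two le_rfl hδ2 hδ)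
  set ν : ℝ := Fintype.card ι / μ with hν
  have hν0 : 0 ≤ ν := by positivity
  -- Here `c₁ = 18/10 c₀` and `c₂ = 11/10 c₀`, so the absorption condition asks for `7/20 c₀`; since
  -- `a + b ≤ 2c`, half of it bounds `c`.
  refine ⟨min η (7 / 40 * c₀ / (Λ ^ 2 * (ν + 1))),
    M * (ν * (1 + Λ * (8 / (18 / 10 * c₀ - 11 / 10 * c₀) + 1 / Λ))) +
      Ly * (8 / (18 / 10 * c₀ - 11 / 10 * c₀) + 1 / Λ), by positivity, ?_, ?_⟩
  · have : 0 < 18 / 10 * c₀ - 11 / 10 * c₀ := by linarith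
    positivity
  intro x hx p q r hpq hpr hqr hab hbc hcω hsep w y F hyL hyM hF
  set K := profileMatrix L x with hK
  set a := angle (x p) (x r) with ha
  set b := angle (x q) (x r) with hb
  set c := angle (x p) (x q) with hc
  have ha0 : 0 ≤ a := angle_nonneg _ _
  have hc0 : 0 ≤ c := angle_nonneg _ _
  have hcη : c ≤ η := hcω.trans (min_le_left _ _)
  have hcab : c ≤ a + b := by
    have := angle_le_angle_add_angle (x p) (x r) (x q)
    rwa [angle_comm (x r) (x q)] at this
  have hKpr : K p r = ntkProfile L a := rfl
  have hKqr : K q r = ntkProfile L b := rfl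
  have hKpq : K p q = ntkProfile L c := rfl
  have hself : ∀ k, K k k = ntkProfile L 0 := profileMatrix_self L hx
  have s1 := hslope 0 a le_rfl ha0 (by linarith)
  have s2 := hslope 0 b le_rfl (by linarith) (by linarith)
  have s3 := hslope b c (by linarith) hbc hcη
  rw [sub_zero] at s1 s2
  refine abs_dotProduct_le_of_dipoles (K := K) (profileMatrix_comm L x) (p := p) (q := q) (r := r)
    (a := a) (b := b) (w := w) (w' := w - w p • (Pi.single p 1 - Pi.single r 1) -
      w q • (Pi.single q 1 - Pi.single r 1)) (α := w p) (β := w q) ha0 (ha0.trans hab) hΛ hμ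
    (by positivity) (by linarith) hLy.le hM.le
    (fun m => abs_profileMatrix_sub_le hlip hΛ.le x p r m)
    (fun m => abs_profileMatrix_sub_le hlip hΛ.le x q r m) ?_ (Or.inr ⟨hab, ?_, ?_⟩) (by abel) ?_ ?_
    hF hyM (hyL p r) (hyL q r)
  · rw [hself, hself, hKpr]; linarith [s1.1]
  · rw [hself, hself, hKqr]; linarith [s2.1]
  -- The interaction is `(f 0 - f a) - (f b - f c)`. The base point `r` faces the longest side `c`,
  -- so `0 ≤ c - b ≤ a`, and both brackets lie between `0` and `11/10 c₀ a`.
  · rw [hself, hKpr, hKqr, hKpq, abs_le]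
    have h5 : 9 / 10 * c₀ * (c - b) ≥ 0 := by
      have : 0 ≤ c - b := by linarith
      positivity
    have h6 : 11 / 10 * c₀ * (c - b) ≤ 11 / 10 * c₀ * a := by gcongr; linarith
    have h7 : 0 ≤ c₀ * a := by positivity
    constructor <;> linarith [s1.1, s1.2, s3.1, s3.2]
  -- The remainder vanishes at `p` and `q`, their mass having moved to `r`, so its support is
  -- separated.
  · refine hcoer x hx p q hpq _ fun k l hkl hk hl => Or.inl ?_
    have hp : ∀ m, (w - w p • (Pi.single p 1 - Pi.single r 1) -
        w q • (Pi.single q 1 - Pi.single r 1) : ι → ℝ) m ≠ 0 → m ≠ p ∧ m ≠ q := by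
      intro m hm
      constructor <;> rintro rfl <;> refine hm ?_
      · simp [hpr, hpq]
      · simp [hqr, hpq.symm]
    have h1 := hp k hk
    have h2 := hp l hl
    have h3 := hsep k l hkl h1.1 h1.2 h2.1 h2.2
    exact abs_inner_le_cos (hx k) (hx l) hδ.le h3.1 h3.2
  · have h1 : c * (Λ ^ 2 * (ν + 1)) ≤ 7 / 40 * c₀ := by
      rw [← le_div_iff₀ (by positivity)]
      exact hcω.trans (min_le_right _ _)
    have h2 : Λ ^ 2 * (a + b) * ν ≤ Λ ^ 2 * (2 * c) * (ν + 1) := by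
      gcongr <;> linarith
    linarith

/-- The label bound for two close inputs that are separated from all others; one pair of inputs may
be nearly antipodal. -/
lemma exists_label_bound_of_pair {L : ℕ} (hL : 1 ≤ L) {δ Ly M : ℝ} (hδ : 0 < δ)
    (hδ2 : δ ≤ Real.pi / 2) (hLy : 0 < Ly) (hM : 0 < M) :
    ∃ ω C : ℝ, 0 < ω ∧ 0 < C ∧ ∀ x : ι → EuclideanSpace ℝ (Fin d), (∀ k, ‖x k‖ = 1) →
      ∀ i j : ι, i ≠ j → angle (x j) (x i) ≤ ω → ∀ q, i ≠ q →
      (∀ k l, k ≠ l → k ≠ j → l ≠ j → δ ≤ angle (x k) (x l) ∧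
        (angle (x k) (x l) ≤ Real.pi - δ ∨ (k = i ∧ l = q ∨ k = q ∧ l = i))) →
      ∀ (w y : ι → ℝ) (F : ℝ), (∀ k l, |y k - y l| ≤ Ly * angle (x k) (x l)) →
        (∀ k, |y k| ≤ M) → (∀ k, |(profileMatrix L x *ᵥ w) k| ≤ F) → |w ⬝ᵥ y| ≤ C * F := by
  have hpi := Real.pi_pos
  obtain ⟨c₀, η, hc₀, hη, hslope⟩ := exists_ntkProfile_slope hL
  obtain ⟨Λ, hΛ, hlip⟩ := exists_ntkProfile_lipschitz L
  obtain ⟨μ, hμ, hcoer⟩ := exists_coercive (ι := ι) (d := d) hL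
    (Real.cos_nonneg_of_neg_pi_div_two_le_of_le (by linarith) hδ2)
    (show Real.cos δ < 1 by
      rw [← Real.cos_zero]
      exact Real.cos_lt_cos_of_nonneg_of_le_pi_div_two le_rfl hδ2 hδ)
  set ν : ℝ := Fintype.card ι / μ with hν
  have hν0 : 0 ≤ ν := by positivity
  refine ⟨min η (7 / 40 * c₀ / (Λ ^ 2 * (ν + 1))),
    M * (ν * (1 + Λ * (8 / (18 / 10 * c₀ - 11 / 10 * c₀) + 1 / Λ))) +
      Ly * (8 / (18 / 10 * c₀ - 11 / 10 * c₀) + 1 / Λ), by positivity, ?_, ?_⟩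
  · have : 0 < 18 / 10 * c₀ - 11 / 10 * c₀ := by linarith
    positivity
  intro x hx i j hij hω q hiq hsep w y F hyL hyM hF
  set K := profileMatrix L x with hK
  set a := angle (x j) (x i) with ha
  have ha0 : 0 ≤ a := angle_nonneg _ _
  have hKji : K j i = ntkProfile L a := rfl
  have hself : ∀ k, K k k = ntkProfile L 0 := profileMatrix_self L hx
  have s1 := hslope 0 a le_rfl ha0 (hω.trans (min_le_left _ _))
  rw [sub_zero] at s1
  refine abs_dotProduct_le_of_dipoles (K := K) (profileMatrix_comm L x) (p := j) (q := j) (r := i)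
    (a := a) (b := a) (w := w) (w' := w - w j • (Pi.single j 1 - Pi.single i 1)) (α := w j) (β := 0)
    ha0 ha0 hΛ hμ (by positivity) (by linarith) hLy.le hM.le
    (fun m => abs_profileMatrix_sub_le hlip hΛ.le x j i m)
    (fun m => abs_profileMatrix_sub_le hlip hΛ.le x j i m) ?_ (Or.inl rfl)
    (by rw [zero_smul]; abel) ?_ ?_ hF hyM (hyL j i) (hyL j i)
  · rw [hself, hself, hKji]; linarith [s1.1]
  · refine hcoer x hx i q hiq _ fun k l hkl hk hl => ?_
    have hp : ∀ m, (w - w j • (Pi.single j 1 - Pi.single i 1) : ι → ℝ) m ≠ 0 → m ≠ j := by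
      rintro m hm rfl
      refine hm ?_
      simp [hij.symm]
    have h3 := hsep k l hkl (hp k hk) (hp l hl)
    by_cases h4 : angle (x k) (x l) ≤ Real.pi - δ
    · exact Or.inl (abs_inner_le_cos (hx k) (hx l) hδ.le h3.1 h4)
    · exact Or.inr ⟨inner_nonpos_of_angle (by linarith [not_le.1 h4]), h3.2.resolve_left h4⟩
  · have h1 : a * (Λ ^ 2 * (ν + 1)) ≤ 7 / 40 * c₀ := by
      rw [← le_div_iff₀ (by positivity)]
      exact hω.trans (min_le_right _ _)
    have h2 : Λ ^ 2 * (a + a) * ν ≤ Λ ^ 2 * (2 * a) * (ν + 1) := by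
      gcongr <;> linarith
    linarith

/-- The dual estimate: a vector `w` pairs with bounded Lipschitz labels within a constant multiple
of the supremum norm of `K w`, uniformly in the position of the close pair `i, j`. -/
lemma exists_label_bound {L : ℕ} (hL : 1 ≤ L) {δ Ly M : ℝ} (hδ : 0 < δ)
    (hδ2 : δ ≤ Real.pi / 2) (hLy : 0 < Ly) (hM : 0 < M) :
    ∃ ω C : ℝ, 0 < ω ∧ 0 < C ∧ ∀ x : ι → EuclideanSpace ℝ (Fin d), (∀ k, ‖x k‖ = 1) →
      ∀ i j : ι, i ≠ j → angle (x i) (x j) ≤ ω →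
      (∀ k l, k ≠ l → k ≠ i → k ≠ j → l ≠ i → l ≠ j →
        δ ≤ angle (x k) (x l) ∧ angle (x k) (x l) ≤ Real.pi - δ) →
      ∀ (w y : ι → ℝ) (F : ℝ), (∀ k l, |y k - y l| ≤ Ly * angle (x k) (x l)) →
        (∀ k, |y k| ≤ M) → (∀ k, |(profileMatrix L x *ᵥ w) k| ≤ F) → |w ⬝ᵥ y| ≤ C * F := by
  obtain ⟨ω₂, C₂, hω₂, hC₂, h₂⟩ := exists_label_bound_of_cluster (ι := ι) (d := d) hL
    (half_pos hδ) (by linarith) hLy hM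
  set ω := min ω₂ (δ / 2) with hω
  have hω0 : 0 < ω := by positivity
  have hωδ : ω ≤ δ / 2 := min_le_right _ _
  obtain ⟨ω₁, C₁, hω₁, hC₁, h₁⟩ := exists_label_bound_of_pair (ι := ι) (d := d) hL
    (half_pos hω0) (by linarith) hLy hM
  refine ⟨min ω₁ (ω / 2), C₁ + C₂, by positivity, by positivity, ?_⟩
  intro x hx i j hij hθ hsep w y F hyL hyM hF
  have hF0 : 0 ≤ F := (abs_nonneg _).trans (hF i)
  have hθ1 : angle (x i) (x j) ≤ ω₁ := hθ.trans (min_le_left _ _)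
  have hθ2 : angle (x i) (x j) ≤ ω / 2 := hθ.trans (min_le_right _ _)
  -- If a fixed input is near the pair, the three form a cluster. Every other fixed input is
  -- separated from this one and from its antipode, hence from the whole cluster, so no antipodal
  -- exception arises. Otherwise the pair is alone.
  by_cases hcl : ∃ k, k ≠ i ∧ k ≠ j ∧ angle (x i) (x k) < ω / 2
  · obtain ⟨k, hki, hkj, hk⟩ := hcl
    have hnear : ∀ m ∈ ({i, j, k} : Finset ι), ∀ m' ∈ ({i, j, k} : Finset ι),
        angle (x m) (x m') ≤ ω := by
      have hself : ∀ m, angle (x m) (x m) = 0 := fun m =>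
        angle_self fun h => by simpa [h] using hx m
      have hjk := angle_le_angle_add_angle (x j) (x i) (x k)
      have hji := angle_comm (x j) (x i)
      intro m hm m' hm'
      simp only [Finset.mem_insert, Finset.mem_singleton] at hm hm'
      rcases hm with rfl | rfl | rfl <;> rcases hm' with rfl | rfl | rfl <;>
        first
        | (rw [hself]; exact hω0.le)
        | linarith
        | (rw [angle_comm]; linarith)
    obtain ⟨p, q, r, hpq, hpr, hqr, hd1, hd2, hset⟩ := exists_sorted_triple
      (fun k l => angle (x k) (x l)) (fun k l => angle_comm _ _) hij hki.symm hkj.symm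
    have hp : p ∈ ({i, j, k} : Finset ι) := by rw [← hset]; simp
    have hq : q ∈ ({i, j, k} : Finset ι) := by rw [← hset]; simp
    have hr : r ∈ ({i, j, k} : Finset ι) := by rw [← hset]; simp
    have hk' : k ∈ ({i, j, k} : Finset ι) := by simp
    have hout : ∀ m, m ≠ p → m ≠ q → m = r ∨ (m ≠ i ∧ m ≠ j ∧ m ≠ k) := by
      intro m h1 h2
      by_cases h : m ∈ ({i, j, k} : Finset ι)
      · rw [← hset] at h
        simp only [Finset.mem_insert, Finset.mem_singleton] at h
        tauto
      · simp only [Finset.mem_insert, Finset.mem_singleton] at h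
        tauto
    have hbase : ∀ m, m ≠ i → m ≠ j → m ≠ k →
        δ / 2 ≤ angle (x r) (x m) ∧ angle (x r) (x m) ≤ Real.pi - δ / 2 := by
      intro m h1 h2 h3
      have h4 := hsep k m h3.symm hki hkj h1 h2
      have h5 := hnear r hr k hk'
      have h6 := angle_le_angle_add_angle (x k) (x r) (x m)
      have h7 := angle_le_angle_add_angle (x r) (x k) (x m)
      rw [angle_comm (x k) (x r)] at h6
      constructor <;> linarith [h4.1, h4.2]
    have h := h₂ x hx p q r hpq hpr hqr hd1 hd2 ((hnear p hp q hq).trans (min_le_left _ _)) ?_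
      w y F hyL hyM hF
    · exact h.trans (mul_le_mul_of_nonneg_right (by linarith) hF0)
    · intro m m' hmm h1 h2 h3 h4
      rcases hout m h1 h2 with rfl | ⟨g1, g2, g3⟩ <;>
        rcases hout m' h3 h4 with rfl | ⟨g1', g2', g3'⟩
      · exact absurd rfl hmm
      · exact hbase m' g1' g2' g3'
      · rw [angle_comm]
        exact hbase m g1 g2 g3
      · have := hsep m m' hmm g1 g2 g1' g2'
        constructor <;> linarith [this.1, this.2]
  · push Not at hcl
    -- Two inputs near the antipode of `x i` would be within `ω ≤ δ / 2` of each other, against the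
    -- separation of fixed inputs.
    have hanti : ∃ q, i ≠ q ∧ ∀ k, k ≠ i → k ≠ j → k ≠ q →
        angle (x i) (x k) ≤ Real.pi - ω / 2 := by
      by_cases hq : ∃ q, q ≠ i ∧ q ≠ j ∧ Real.pi - ω / 2 < angle (x i) (x q)
      · obtain ⟨q, hqi, hqj, hq⟩ := hq
        refine ⟨q, hqi.symm, fun k hki hkj hkq => ?_⟩
        by_contra! hk
        have h1 := (hsep k q hkq hki hkj hqi hqj).1
        have h2 := angle_le_angle_add_angle (x k) (-x i) (x q)
        rw [angle_neg_left, angle_neg_right, angle_comm (x k) (x i)] at h2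
        linarith
      · push Not at hq
        -- Without a nearly antipodal input, `q = j` makes the exception void, since `j` is excluded
        -- from the separation condition.
        exact ⟨j, hij, fun k hki hkj _ => hq k hki hkj⟩
    obtain ⟨q, hiq, hq⟩ := hanti
    have h := h₁ x hx i j hij (by rwa [angle_comm]) q hiq ?_ w y F hyL hyM hF
    · exact h.trans (mul_le_mul_of_nonneg_right (by linarith) hF0)
    · intro k l hkl hkj hlj
      by_cases hki : k = i
      · subst hki
        refine ⟨hcl l hkl.symm hlj, ?_⟩
        by_cases hlq : l = q
        · exact Or.inr (Or.inl ⟨rfl, hlq⟩)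
        · exact Or.inl (hq l hkl.symm hlj hlq)
      by_cases hli : l = i
      · subst hli
        rw [angle_comm]
        refine ⟨hcl k hki hkj, ?_⟩
        by_cases hkq : k = q
        · exact Or.inr (Or.inr ⟨hkq, rfl⟩)
        · exact Or.inl (hq k hki hkj hkq)
      have := hsep k l hkl hki hkj hli hlj
      exact ⟨by linarith [this.1], Or.inl (by linarith [this.2])⟩

end LabelBound

/-! ### An eigenvalue of order at most the angle, and its test vector -/

section Eigenpair

variable {ι : Type*} [Fintype ι] {d : ℕ}

lemma exists_pos_le_of_finite {α : Type*} [Finite α] {f : α → ℝ} (hf : ∀ a, 0 < f a) :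
    ∃ δ > 0, ∀ a, δ ≤ f a := by
  rcases isEmpty_or_nonempty α with h | h
  · exact ⟨1, one_pos, fun a => h.elim a⟩
  · obtain ⟨a, ha⟩ := Finite.exists_min f
    exact ⟨f a, hf a, ha⟩

lemma abs_le_one_of_dotProduct_self {v : ι → ℝ} (hv : v ⬝ᵥ v = 1) (k : ι) : |v k| ≤ 1 := by
  rw [← sq_le_one_iff_abs_le_one, ← hv, sq]
  exact Finset.single_le_sum (f := fun k => v k * v k) (fun l _ => mul_self_nonneg _)
    (Finset.mem_univ k)

variable [DecidableEq ι]

/-- The quadratic form on the span of two dipoles sharing the base point `r`. -/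
lemma dipole_form_le {K : Matrix ι ι ℝ} (hsym : ∀ k l, K k l = K l k) {p q r : ι} (hpq : p ≠ q)
    (hpr : p ≠ r) (hqr : q ≠ r) {e Λ : ℝ} (hKp : ∀ m, |K p m - K r m| ≤ Λ * e)
    (hKq : ∀ m, |K q m - K r m| ≤ Λ * e) (hΛe : 0 ≤ Λ * e) (α β : ℝ) :
    (α • (Pi.single p 1 - Pi.single r 1) + β • (Pi.single q 1 - Pi.single r 1) : ι → ℝ) ⬝ᵥ
      (K *ᵥ (α • (Pi.single p 1 - Pi.single r 1) + β • (Pi.single q 1 - Pi.single r 1))) ≤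
    4 * (Λ * e) * ((α • (Pi.single p 1 - Pi.single r 1) + β • (Pi.single q 1 - Pi.single r 1) :
      ι → ℝ) ⬝ᵥ (α • (Pi.single p 1 - Pi.single r 1) + β • (Pi.single q 1 - Pi.single r 1))) := by
  have e1 : (α • (Pi.single p 1 - Pi.single r 1) + β • (Pi.single q 1 - Pi.single r 1) : ι → ℝ) ⬝ᵥ
      (K *ᵥ (α • (Pi.single p 1 - Pi.single r 1) + β • (Pi.single q 1 - Pi.single r 1))) =
      α ^ 2 * ((K p p - K r p) - (K p r - K r r)) +
        2 * (α * β) * ((K p q - K r q) - (K p r - K r r)) +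
        β ^ 2 * ((K q q - K r q) - (K q r - K r r)) := by
    simp only [mulVec_add, mulVec_smul, mulVec_sub, mulVec_single_one, dotProduct_add,
      add_dotProduct, smul_dotProduct, dotProduct_smul, sub_dotProduct, dotProduct_sub,
      single_one_dotProduct, smul_eq_mul, Matrix.col_apply]
    rw [hsym q p, hsym r p, hsym r q]
    ring
  have e2 : (α • (Pi.single p 1 - Pi.single r 1) + β • (Pi.single q 1 - Pi.single r 1) : ι → ℝ) ⬝ᵥ
      (α • (Pi.single p 1 - Pi.single r 1) + β • (Pi.single q 1 - Pi.single r 1)) =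
      α ^ 2 + β ^ 2 + (α + β) ^ 2 := by
    simp only [dotProduct_add, add_dotProduct, smul_dotProduct, dotProduct_smul, sub_dotProduct,
      dotProduct_sub, single_one_dotProduct, smul_eq_mul, Pi.single_eq_same,
      Pi.single_eq_of_ne hpq, Pi.single_eq_of_ne hpr, Pi.single_eq_of_ne hqr,
      Pi.single_eq_of_ne hpq.symm, Pi.single_eq_of_ne hpr.symm, Pi.single_eq_of_ne hqr.symm]
    ring
  rw [e1, e2]
  have b1 : |(K p p - K r p) - (K p r - K r r)| ≤ 2 * (Λ * e) :=
    (abs_sub _ _).trans (by linarith [hKp p, hKp r])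
  have b2 : |(K p q - K r q) - (K p r - K r r)| ≤ 2 * (Λ * e) :=
    (abs_sub _ _).trans (by linarith [hKp q, hKp r])
  have b3 : |(K q q - K r q) - (K q r - K r r)| ≤ 2 * (Λ * e) :=
    (abs_sub _ _).trans (by linarith [hKq q, hKq r])
  have t1 := mul_le_mul_of_nonneg_left ((le_abs_self _).trans b1) (sq_nonneg α)
  have t3 := mul_le_mul_of_nonneg_left ((le_abs_self _).trans b3) (sq_nonneg β)
  have t2 : 2 * (α * β) * ((K p q - K r q) - (K p r - K r r)) ≤
      (α ^ 2 + β ^ 2) * (2 * (Λ * e)) := by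
    refine (le_abs_self _).trans ?_
    rw [abs_mul]
    refine mul_le_mul ?_ b2 (abs_nonneg _) (by positivity)
    rw [abs_le]
    constructor <;> linarith [sq_nonneg (α + β), sq_nonneg (α - β)]
  have t4 : 0 ≤ Λ * e * (α + β) ^ 2 := by positivity
  linarith

/-- An eigenpair with eigenvalue at most of the order of the angle of the close pair, together with
a unit vector `u` that takes equal values on inputs much closer than that angle and on which the
kernel is no larger than the eigenvalue. -/
lemma exists_eigenpair {L : ℕ} {Λ δ : ℝ} (hΛ : 0 < Λ)
    (hlip : ∀ s t : ℝ, 0 ≤ s → s ≤ Real.pi → 0 ≤ t → t ≤ Real.pi →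
      |ntkProfile L t - ntkProfile L s| ≤ Λ * |t - s|)
    {x : ι → EuclideanSpace ℝ (Fin d)} (hx : ∀ k, ‖x k‖ = 1) {i j : ι} (hij : i ≠ j)
    (hθ : angle (x i) (x j) ≤ δ / 2)
    (hsep : ∀ k l, k ≠ l → k ≠ i → k ≠ j → l ≠ i → l ≠ j → δ ≤ angle (x k) (x l)) :
    ∃ (lam : ℝ) (v u : ι → ℝ), 0 ≤ lam ∧ lam ≤ 8 * Λ * angle (x i) (x j) ∧ v ⬝ᵥ v = 1 ∧
      profileMatrix L x *ᵥ v = lam • v ∧ u ⬝ᵥ u = 1 ∧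
      (∀ k l, u k = u l ∨ angle (x i) (x j) / 2 ≤ angle (x k) (x l)) ∧
      (profileMatrix L x *ᵥ u) ⬝ᵥ (profileMatrix L x *ᵥ u) ≤ lam ^ 2 := by
  set K := profileMatrix L x with hK
  have hPSD : K.PosSemidef := profileMatrix_posSemidef L hx
  have hKd : ∀ k l m, |K k m - K l m| ≤ Λ * angle (x k) (x l) :=
    abs_profileMatrix_sub_le hlip hΛ.le x
  -- A pair closer than `θ / 2` must consist of one of `i`, `j` and a fixed input; the names `a`,
  -- `b`, `k` below are chosen so that `a`, `k` is that pair.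
  by_cases hclose : ∃ k l, k ≠ l ∧ angle (x k) (x l) < angle (x i) (x j) / 2
  · have hred : ∃ a b k, a ≠ b ∧ k ≠ a ∧ k ≠ b ∧ angle (x a) (x b) = angle (x i) (x j) ∧
        angle (x a) (x k) < angle (x i) (x j) / 2 ∧
        (∀ m m', m ≠ m' → m ≠ a → m ≠ b → m' ≠ a → m' ≠ b → δ ≤ angle (x m) (x m')) := by
      obtain ⟨k, l, hkl, hlt⟩ := hclose
      have h0 := angle_nonneg (x i) (x j)
      have hsep' : ∀ m m', m ≠ m' → m ≠ j → m ≠ i → m' ≠ j → m' ≠ i →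
          δ ≤ angle (x m) (x m') := fun m m' h1 h2 h3 h4 h5 => hsep m m' h1 h3 h2 h5 h4
      have hcomm := angle_comm (x j) (x i)
      by_cases hki : k = i
      · subst hki
        by_cases hlj : l = j
        · subst hlj; linarith
        · exact ⟨k, j, l, hij, hkl.symm, hlj, rfl, hlt, hsep⟩
      by_cases hkj : k = j
      · subst hkj
        by_cases hli : l = i
        · subst hli; linarith
        · exact ⟨k, i, l, hij.symm, hkl.symm, hli, hcomm, hlt, hsep'⟩
      rw [angle_comm] at hlt
      by_cases hli : l = i
      · subst hli
        exact ⟨l, j, k, hij, hki, hkj, rfl, hlt, hsep⟩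
      by_cases hlj : l = j
      · subst hlj
        exact ⟨l, i, k, hij.symm, hkj, hki, hcomm, hlt, hsep'⟩
      have := hsep l k hkl.symm hli hlj hki hkj
      linarith
    obtain ⟨a, b, k, hab, hka, hkb, hθab, hak, hsep'⟩ := hred
    set θ := angle (x i) (x j) with hθdef
    have hθ0 : 0 ≤ θ := angle_nonneg _ _
    have hbk : angle (x b) (x k) ≤ 2 * θ := by
      have := angle_le_angle_add_angle (x b) (x a) (x k)
      rw [angle_comm (x b) (x a)] at this
      linarith
    have hbk' : θ / 2 ≤ angle (x b) (x k) := by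
      have := angle_le_angle_add_angle (x a) (x k) (x b)
      rw [angle_comm (x k) (x b)] at this
      linarith
    have hΛθ : 0 ≤ Λ * (2 * θ) := by positivity
    have hind : ∀ α β : ℝ, α • (Pi.single a 1 - Pi.single k 1 : ι → ℝ) +
        β • (Pi.single b 1 - Pi.single k 1) = 0 → α = 0 ∧ β = 0 := by
      intro α β h
      have ha := congrFun h a
      have hb := congrFun h b
      simp [hab, hka.symm] at ha
      simp [hab.symm, hkb.symm] at hb
      exact ⟨ha, hb⟩
    obtain ⟨lam, v, u, h0, h1, h2, h3, h4, h5, h6⟩ := exists_eigenvector_of_plane hPSD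
      (B := 4 * (Λ * (2 * θ))) (u₁ := Pi.single a 1 - Pi.single k 1)
      (u₂ := Pi.single b 1 - Pi.single k 1) hind
      (dipole_form_le (profileMatrix_comm L x) hab hka.symm hkb.symm
        (fun m => (hKd a k m).trans (mul_le_mul_of_nonneg_left (by linarith) hΛ.le))
        (fun m => (hKd b k m).trans (mul_le_mul_of_nonneg_left hbk hΛ.le)) hΛθ)
      -- The functional forces `u a = u k`. All other pairs are at least `θ / 2` apart, so `u`
      -- scaled by a multiple of `θ` is Lipschitz.
      (LinearMap.proj (R := ℝ) (φ := fun _ : ι => ℝ) a - LinearMap.proj k)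
    refine ⟨lam, v, u, h0, by linarith, h2, h3, h4, fun m l => ?_, h6⟩
    have hu : u a = u k := by
      simpa [sub_eq_zero] using h5
    by_cases hml : m = l
    · exact Or.inl (by rw [hml])
    have main : ∀ m l, m ≠ l → l ≠ a → l ≠ b → u m = u l ∨ θ / 2 ≤ angle (x m) (x l) := by
      intro m l hml hla hlb
      by_cases hlk : l = k
      · subst hlk
        by_cases hma : m = a
        · subst hma; exact Or.inl hu
        by_cases hmb : m = b
        · subst hmb; exact Or.inr hbk'
        have := hsep' m l hml hma hmb hla hlb
        exact Or.inr (by linarith)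
      have hkl := hsep' k l (Ne.symm hlk) hka hkb hla hlb
      right
      by_cases hma : m = a
      · subst hma
        have := angle_le_angle_add_angle (x k) (x m) (x l)
        rw [angle_comm (x k) (x m)] at this
        linarith
      by_cases hmb : m = b
      · subst hmb
        have := angle_le_angle_add_angle (x k) (x m) (x l)
        rw [angle_comm (x k) (x m)] at this
        have h7 := angle_le_angle_add_angle (x m) (x a) (x k)
        rw [angle_comm (x m) (x a)] at h7
        linarith
      have := hsep' m l hml hma hmb hla hlb
      linarith
    by_cases hl : l ≠ a ∧ l ≠ b
    · exact main m l hml hl.1 hl.2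
    by_cases hm : m ≠ a ∧ m ≠ b
    · rw [angle_comm, eq_comm]
      exact main l m (Ne.symm hml) hm.1 hm.2
    right
    have hcomm := angle_comm (x b) (x a)
    have hl' : l = a ∨ l = b := by tauto
    have hm' : m = a ∨ m = b := by tauto
    rcases hl' with rfl | rfl <;> rcases hm' with rfl | rfl
    · exact absurd rfl hml
    · linarith
    · linarith
    · exact absurd rfl hml
  · push Not at hclose
    set θ := angle (x i) (x j) with hθdef
    have hθ0 : 0 ≤ θ := angle_nonneg _ _
    have hform : (Pi.single i 1 - Pi.single j 1 : ι → ℝ) ⬝ᵥ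
        (K *ᵥ (Pi.single i 1 - Pi.single j 1)) = (K i i - K j i) - (K i j - K j j) := by
      simp only [mulVec_sub, mulVec_single_one, sub_dotProduct, dotProduct_sub,
        single_one_dotProduct, Matrix.col_apply]
    have hsq : (Pi.single i 1 - Pi.single j 1 : ι → ℝ) ⬝ᵥ (Pi.single i 1 - Pi.single j 1) = 2 := by
      simp only [sub_dotProduct, dotProduct_sub, single_one_dotProduct, Pi.single_eq_same,
        Pi.single_eq_of_ne hij, Pi.single_eq_of_ne hij.symm]
      norm_num
    obtain ⟨lam, v, h0, h1, h2, h3⟩ := exists_eigenvector_of_rayleigh hPSD (B := 8 * Λ * θ)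
      (u := Pi.single i 1 - Pi.single j 1) (fun h => by rw [h] at hsq; simp at hsq) (by
        rw [hform, hsq]
        have := (abs_le.1 (hKd i j i)).2
        have := (abs_le.1 (hKd i j j)).1
        have : 0 ≤ Λ * θ := by positivity
        linarith)
    refine ⟨lam, v, v, h0, h1, h2, h3, h2, fun k l => ?_, ?_⟩
    · by_cases hkl : k = l
      · exact Or.inl (by rw [hkl])
      · exact Or.inr (hclose k l hkl)
    · rw [h3, dotProduct_smul, smul_dotProduct, h2]
      simp [sq]

end Eigenpair

variable {d : ℕ}

lemma ntkMatrix_eq_profileMatrix {n : ℕ} (L : ℕ) {x : Fin n → EuclideanSpace ℝ (Fin d)}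
    (hx : ∀ k, ‖x k‖ = 1) : ntkMatrix L x = profileMatrix L x := by
  ext k l
  exact ntk_eq_ntkProfile L (hx k) (hx l)

lemma AdmissibleInputs.angle_mem_Ioo {n : ℕ} {x : Fin n → EuclideanSpace ℝ (Fin d)}
    (hx : AdmissibleInputs x) {k l : Fin n} (hkl : k ≠ l) :
    0 < angle (x k) (x l) ∧ angle (x k) (x l) < Real.pi := by
  constructor
  · refine lt_of_le_of_ne (angle_nonneg _ _) fun h => ?_
    obtain ⟨-, r, -, hr⟩ := angle_eq_zero_iff.1 h.symm
    exact hx.nonparallel l k hkl.symm ⟨r, hr⟩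
  · refine lt_of_le_of_ne (angle_le_pi _ _) fun h => ?_
    obtain ⟨-, r, -, hr⟩ := angle_eq_pi_iff.1 h
    exact hx.nonparallel l k hkl.symm ⟨r, hr⟩

end InfiniteNTK

end

/-! ### Assembly of the theorem -/

theorem theorem3p2 (n d L : ℕ) (hn : 2 < n) (hL : 1 ≤ L) (i j : Fin n) (hij : i ≠ j)
    (Ly M : ℝ) (hLy : 0 < Ly) (hM : 0 < M)
    (z : {k : Fin n // k ≠ i ∧ k ≠ j} → EuclideanSpace ℝ (Fin d)) :
    ∃ c C θ₀ : ℝ, 0 < c ∧ 0 < C ∧ 0 < θ₀ ∧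
      ∀ x : Fin n → EuclideanSpace ℝ (Fin d),
        InfiniteNTK.AdmissibleInputs x →
        (∀ k : {k : Fin n // k ≠ i ∧ k ≠ j}, x k = z k) →
        InnerProductGeometry.angle (x i) (x j) ≤ θ₀ →
        ∃ (lam : ℝ) (v : Fin n → ℝ),
          -- an eigenpair of the NTK matrix with a unit eigenvector
          v ⬝ᵥ v = 1 ∧ InfiniteNTK.ntkMatrix L x *ᵥ v = lam • v ∧
          -- the eigenvalue is of order `θ`
          c * InnerProductGeometry.angle (x i) (x j) ≤ lam ∧
          lam ≤ C * InnerProductGeometry.angle (x i) (x j) ∧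
          -- the squared label projection is of order at most `lam ^ 2` for all admissible labels
          (∀ y : Fin n → ℝ, InfiniteNTK.LipschitzLabels Ly x y → (∀ k, |y k| ≤ M) →
            (v ⬝ᵥ y) ^ 2 ≤ C * lam ^ 2) ∧
          -- and the order `lam ^ 2` is attained by some admissible labels
          (∃ y : Fin n → ℝ, InfiniteNTK.LipschitzLabels Ly x y ∧ (∀ k, |y k| ≤ M) ∧
            c * lam ^ 2 ≤ (v ⬝ᵥ y) ^ 2) := by
  open InfiniteNTK InnerProductGeometry in
  by_cases hex : ∃ x : Fin n → EuclideanSpace ℝ (Fin d), AdmissibleInputs x ∧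
      ∀ k : {k : Fin n // k ≠ i ∧ k ≠ j}, x k = z k
  swap
  · exact ⟨1, 1, 1, one_pos, one_pos, one_pos, fun x hx hxz _ => absurd ⟨x, hx, hxz⟩ hex⟩
  have hpi := Real.pi_pos
  have hnpos : (0 : ℝ) < n := by exact_mod_cast (by omega : 0 < n)
  obtain ⟨δ', hδ', hδz⟩ := exists_pos_le_of_finite
    (α := {p : {k : Fin n // k ≠ i ∧ k ≠ j} × {k : Fin n // k ≠ i ∧ k ≠ j} // p.1 ≠ p.2})
    (f := fun p => min (angle (z p.1.1) (z p.1.2)) (Real.pi - angle (z p.1.1) (z p.1.2)))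
    (fun ⟨p, hp⟩ => by
      obtain ⟨x, hx, hxz⟩ := hex
      have h := hx.angle_mem_Ioo (k := p.1) (l := p.2) (fun h => hp (Subtype.ext h))
      rw [hxz, hxz] at h
      exact lt_min h.1 (by linarith [h.2]))
  set δ := min δ' (Real.pi / 2) with hδdef
  have hδ : 0 < δ := by positivity
  obtain ⟨ω, C₀, hω, hC₀, hbound⟩ := exists_label_bound (ι := Fin n) (d := d) hL hδ
    (min_le_right _ _) hLy hM
  obtain ⟨Λ, hΛ, hlip⟩ := exists_ntkProfile_lipschitz L
  -- `κ` makes `κ θ u`, and `τ` makes `τ λ v`, an admissible label; in each minimum the first entry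
  -- serves the Lipschitz bound and the second the bound `M`.
  set κ := min (Ly / (2 * Real.pi)) (M / Real.pi) with hκ
  have hκ0 : 0 < κ := by positivity
  set τ := min (Ly / (Λ * n * (Real.pi / 2))) (M / (8 * Λ * Real.pi)) with hτ
  have hτ0 : 0 < τ := by positivity
  refine ⟨min (κ / C₀) (τ ^ 2), 8 * Λ + C₀ ^ 2, min ω (δ / 2), by positivity, by positivity,
    by positivity, ?_⟩
  intro x hx hxz hθ
  have hsep : ∀ k l, k ≠ l → k ≠ i → k ≠ j → l ≠ i → l ≠ j →
      δ ≤ angle (x k) (x l) ∧ angle (x k) (x l) ≤ Real.pi - δ := by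
    intro k l hkl hki hkj hli hlj
    have h := hδz ⟨(⟨k, hki, hkj⟩, ⟨l, hli, hlj⟩), fun h => hkl (congrArg Subtype.val h)⟩
    rw [← hxz, ← hxz] at h
    have h1 := h.trans (min_le_left _ _)
    have h2 := h.trans (min_le_right _ _)
    have h3 : δ ≤ δ' := min_le_left _ _
    constructor <;> linarith
  obtain ⟨lam, v, u, h0, hle, hv, heig, hu, hueq, hKu⟩ := exists_eigenpair hΛ hlip hx.unit hij
    (hθ.trans (min_le_right _ _)) (fun k l h1 h2 h3 h4 h5 => (hsep k l h1 h2 h3 h4 h5).1)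
  have hdual := hbound x hx.unit i j hij (hθ.trans (min_le_left _ _)) hsep
  set K := profileMatrix L x with hK
  set θ := angle (x i) (x j) with hθdef
  have hθ0 : 0 ≤ θ := angle_nonneg _ _
  have hθpi : θ ≤ Real.pi := angle_le_pi _ _
  have hv1 := abs_le_one_of_dotProduct_self hv
  have hu1 := abs_le_one_of_dotProduct_self hu
  -- The dual estimate with `w = u` and `y = κ θ u`: the pairing equals `κ θ`, and `|(K u)_k| ≤ λ`.
  have hlow : κ * θ ≤ C₀ * lam := by
    have hF : ∀ k, |(K *ᵥ u) k| ≤ lam := by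
      intro k
      refine abs_le_of_sq_le_sq (le_trans ?_ hKu) h0
      rw [sq]
      exact Finset.single_le_sum (f := fun k => (K *ᵥ u) k * (K *ᵥ u) k)
        (fun l _ => mul_self_nonneg _) (Finset.mem_univ k)
    have h := hdual u ((κ * θ) • u) lam (fun k l => ?_) (fun k => ?_) hF
    · rw [dotProduct_smul, hu, smul_eq_mul, mul_one] at h
      exact (le_abs_self _).trans h
    · rw [Pi.smul_apply, Pi.smul_apply, smul_eq_mul, smul_eq_mul, ← mul_sub, abs_mul,
        abs_of_nonneg (by positivity : 0 ≤ κ * θ)]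
      rcases hueq k l with h | h
      · rw [h, sub_self, abs_zero, mul_zero]
        exact mul_nonneg hLy.le (angle_nonneg _ _)
      · have h1 : |u k - u l| ≤ 2 := (abs_sub _ _).trans (by linarith [hu1 k, hu1 l])
        have h2 : κ * (2 * Real.pi) ≤ Ly := by
          rw [← le_div_iff₀ (by positivity)]; exact min_le_left _ _
        have h3 : κ * 6 ≤ κ * (2 * Real.pi) := by
          gcongr; linarith [Real.pi_gt_three]
        calc κ * θ * |u k - u l| ≤ κ * θ * 2 := by gcongr
          _ ≤ κ * 4 * (θ / 2) := by linarith
          _ ≤ Ly * angle (x k) (x l) := by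
            refine mul_le_mul (by linarith) h (by positivity) hLy.le
    · rw [Pi.smul_apply, smul_eq_mul, abs_mul, abs_of_nonneg (by positivity : 0 ≤ κ * θ)]
      calc κ * θ * |u k| ≤ κ * Real.pi * 1 := by gcongr; exact hu1 k
        _ ≤ M := by
          rw [mul_one, ← le_div_iff₀ hpi]; exact min_le_right _ _
  refine ⟨lam, v, hv, by rw [ntkMatrix_eq_profileMatrix L hx.unit]; exact heig, ?_, ?_, ?_, ?_⟩
  · calc min (κ / C₀) (τ ^ 2) * θ ≤ κ / C₀ * θ := by gcongr; exact min_le_left _ _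
      _ ≤ lam := by
        rw [div_mul_eq_mul_div, div_le_iff₀ hC₀]
        linarith
  · refine hle.trans (mul_le_mul_of_nonneg_right ?_ hθ0)
    linarith [sq_nonneg C₀]
  · intro y hyL hyM
    have h := hdual v y lam (fun k l => (hyL k l).trans (mul_le_mul_of_nonneg_left
      (norm_sub_le_angle (hx.unit k) (hx.unit l)) hLy.le)) hyM (fun k => ?_)
    · calc (v ⬝ᵥ y) ^ 2 = |v ⬝ᵥ y| ^ 2 := (sq_abs _).symm
        _ ≤ (C₀ * lam) ^ 2 := by gcongr
        _ ≤ (8 * Λ + C₀ ^ 2) * lam ^ 2 := by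
          have : 0 ≤ 8 * Λ * lam ^ 2 := by positivity
          linarith
    · rw [heig, Pi.smul_apply, smul_eq_mul, abs_mul, abs_of_nonneg h0]
      exact mul_le_of_le_one_right h0 (hv1 k)
  · refine ⟨(τ * lam) • v, fun k l => ?_, fun k => ?_, ?_⟩
    -- The eigenvalue equation transfers the Lipschitz bound of the rows of `K` to `λ v`. The bound
    -- comes in angles, and the factor `π / 2` in `τ` converts it to chords.
    · have e : lam * v k - lam * v l = ∑ m, (K k m - K l m) * v m := by
        have h1 := congrFun heig k
        have h2 := congrFun heig l
        rw [Pi.smul_apply, smul_eq_mul] at h1 h2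
        rw [← h1, ← h2]
        simp only [mulVec, dotProduct, ← Finset.sum_sub_distrib, sub_mul]
      have h1 : |lam * v k - lam * v l| ≤ Λ * angle (x k) (x l) * n := by
        rw [e]
        refine (abs_sum_mul_le fun m => abs_profileMatrix_sub_le hlip hΛ.le x k l m).trans ?_
        refine mul_le_mul_of_nonneg_left ?_ (mul_nonneg hΛ.le (angle_nonneg _ _))
        calc ∑ m, |v m| ≤ ∑ _m : Fin n, (1 : ℝ) := Finset.sum_le_sum fun m _ => hv1 m
          _ = n := by simp
      have h2 := angle_le_norm_sub (hx.unit k) (hx.unit l)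
      rw [div_mul_eq_mul_div, div_le_iff₀ hpi] at h2
      have h3 : τ * (Λ * n * (Real.pi / 2)) ≤ Ly := by
        rw [← le_div_iff₀ (by positivity)]; exact min_le_left _ _
      rw [Pi.smul_apply, Pi.smul_apply, smul_eq_mul, smul_eq_mul, mul_assoc, mul_assoc, ← mul_sub,
        abs_mul, abs_of_pos hτ0]
      calc τ * |lam * v k - lam * v l| ≤ τ * (Λ * (‖x k - x l‖ * Real.pi / 2) * n) := by
            refine mul_le_mul_of_nonneg_left (h1.trans ?_) hτ0.le
            gcongr
            linarith
        _ = τ * (Λ * n * (Real.pi / 2)) * ‖x k - x l‖ := by ring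
        _ ≤ Ly * ‖x k - x l‖ := by gcongr
    · have h1 : τ * (8 * Λ * Real.pi) ≤ M := by
        rw [← le_div_iff₀ (by positivity)]; exact min_le_right _ _
      rw [Pi.smul_apply, smul_eq_mul, abs_mul, abs_of_nonneg (by positivity : 0 ≤ τ * lam)]
      calc τ * lam * |v k| ≤ τ * lam * 1 := by gcongr; exact hv1 k
        _ ≤ τ * (8 * Λ * Real.pi) := by
          rw [mul_one]
          refine mul_le_mul_of_nonneg_left (hle.trans ?_) hτ0.le
          gcongr
        _ ≤ M := h1
    · rw [dotProduct_smul, hv, smul_eq_mul, mul_one, mul_pow]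
      exact mul_le_mul_of_nonneg_right (min_le_right _ _) (sq_nonneg _)
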